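/- Let $\mathcal S,\mathcal A$ be finite nonempty sets and let $(\mathcal S,\mathcal A,\{P_a\},\mathcal R,\gamma)$ be a discounted MDP with transition matrices $P_a$, rewards $\mathcal R(s,a)\in[0,1]$ and $\gamma\in(0,1)$. Let $Q^*(s,a)=\sup_\pi \mathbb E_\pi\big[\sum_{k\ge 0}\gamma^k\mathcal R(S_k,A_k)\mid S_0=s,A_0=a\big]$, the supremum being over stationary randomized policies. Let $\pi_b$ be a behavior policy with $\pi_b(a|s)>0$ for all $(s,a)$ whose state chain, with transition matrix $P_{\pi_b}(s,s')=\sum_a\pi_b(a|s)P_a(s,s')$, is irreducible and aperiodic, with stationary distribution $\mu$. For $\delta>0$ let $t_\delta=\min\{k\ge 0:\max_s\|P_{\pi_b}^k(s,\cdot)-\mu\|_{\mathrm{TV}}\le\delta\}$. Let $\Phi\in\mathbb R^{|\mathcal S||\mathcal A|\times d}$ be a feature matrix with rows $\phi(s,a)^\top$, linearly independent columns and $\|\phi(s,a)\|_1\le 1$ for all $(s,a)$, and assume that it is square, $d=|\mathcal S||\mathcal A|$. Let $D$ be the diagonal matrix with entries $\mu(s)\pi_b(a|s)$, and let $\lambda_{\min}$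 be the smallest eigenvalue of $\Phi^\top D\Phi$. Consider $Q$-learning with target network and without truncation, with constant stepsize $\alpha>0$ and inner-loop length $K$. Along a single trajectory $S_0,A_0,S_1,A_1,\dots$ with $A_k\sim\pi_b(\cdot|S_k)$, $S_{k+1}\sim P_{A_k}(S_k,\cdot)$ and an arbitrary initial law, put $\hat\theta_0=0$. For $t=0,1,2,\dots$ let $\theta_{t,0}=0$ and, for $0\le k<K$ and $n=tK+k$, $$\theta_{t,k+1}=\theta_{t,k}+\alpha\,\phi(S_n,A_n)\Big(\mathcal R(S_n,A_n)+\gamma\max_{a'\in\mathcal A}\phi(S_{n+1},a')^\top\hat\theta_t-\phi(S_n,A_n)^\top\theta_{t,k}\Big),$$ and let $\hat\theta_{t+1}=\theta_{t,K}$. Thus $\hat\theta_T$ uses $KT$ samples. Then the sample complexity to achieve $\mathbb E\|\Phi\hat\theta_T-Q^*\|_\infty<\epsilon$ under the conditions $\alpha\le\lambda_{\min}(1-\gamma)^2/130$ and $K\ge t_\alpha+1$ is $\tilde{\mathcal O}(\epsilon^{-2})$, and the accuracy is kept when the algorithm continues to run. Precisely, there is a universal exponent $p\in\mathbb N$ such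 that for every MDP, $\pi_b$ and $\Phi$ as above there is a constant $C>0$ (depending on these data, but not on $\epsilon$ or on the initial law) such that for every $\epsilon\in(0,1)$ there are a stepsize $0<\alpha\le\lambda_{\min}(1-\gamma)^2/130$ and integers $K\ge t_\alpha+1$ and $T\ge0$ with $$KT\le C\,\epsilon^{-2}\,\big(1+\log(1/\epsilon)\big)^p$$ and, for every initial law of $S_0$, $\ \mathbb E\|\Phi\hat\theta_{T'}-Q^*\|_\infty<\epsilon$ for all $T'\ge T$. -/

import Mathlib

open scoped Matrix

noncomputable section

namespace TargetQ

/-- A finite discounted Markov decision process: transition probabilities `P a s s'`,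
rewards `R s a` in `[0, 1]`, discount factor `γ` in `(0, 1)`. -/
structure MDP (S A : Type*) [Fintype S] where
  P : A → Matrix S S ℝ
  P_nonneg : ∀ a s s', 0 ≤ P a s s'
  P_sum : ∀ a s, ∑ s', P a s s' = 1
  R : S → A → ℝ
  R_nonneg : ∀ s a, 0 ≤ R s a
  R_le_one : ∀ s a, R s a ≤ 1
  γ : ℝ
  γ_pos : 0 < γ
  γ_lt_one : γ < 1

/-- A stationary randomized policy: `prob s a` is the probability of action `a` in state `s`. -/
structure Policy (S A : Type*) [Fintype A] where
  prob : S → A → ℝ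
  nonneg : ∀ s a, 0 ≤ prob s a
  sum_eq_one : ∀ s, ∑ a, prob s a = 1

section Chains

variable {S A : Type*} [Fintype S] [Fintype A] [DecidableEq S] [DecidableEq A]

/-- Transition matrix of the state chain `S₀, S₁, …` under the policy `π`. -/
def stateMatrix (M : MDP S A) (π : Policy S A) : Matrix S S ℝ :=
  Matrix.of fun s s' => ∑ a, π.prob s a * M.P a s s'

/-- Transition matrix of the state-action chain `(S₀, A₀), (S₁, A₁), …` under the policy `π`. -/
def stateActionMatrix (M : MDP S A) (π : Policy S A) : Matrix (S × A) (S × A) ℝ :=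
  Matrix.of fun x y => M.P x.2 x.1 y.1 * π.prob y.1 y.2

/-- The value function `Q^π(s, a) = E[∑ₖ γᵏ R(Sₖ, Aₖ) | S₀ = s, A₀ = a]` of the policy `π`;
the `k`-th conditional expectation is the `(s, a)` entry of the `k`-th power of the state-action
transition matrix applied to the reward vector. -/
def qPolicy (M : MDP S A) (π : Policy S A) (x : S × A) : ℝ :=
  ∑' k : ℕ, M.γ ^ k * ((stateActionMatrix M π ^ k) *ᵥ fun y => M.R y.1 y.2) x

/-- The optimal value function: the supremum of `Q^π(s, a)` over all policies. -/
def qStar (M : MDP S A) (x : S × A) : ℝ :=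
  ⨆ π : Policy S A, qPolicy M π x

/-- `μ` is a stationary probability distribution of the transition matrix `P`. -/
def IsStationary (P : Matrix S S ℝ) (μ : S → ℝ) : Prop :=
  (∀ s, 0 ≤ μ s) ∧ ∑ s, μ s = 1 ∧ μ ᵥ* P = μ

/-- The stationary distribution of the transition matrix `P` (unique if `P` is irreducible). -/
def stationaryDist (P : Matrix S S ℝ) : S → ℝ :=
  Classical.epsilon (IsStationary P)

/-- Every state has period one: the greatest common divisor of its possible return times is `1`. -/
def IsAperiodic (P : Matrix S S ℝ) : Prop :=
  ∀ s, ∀ m : ℕ, (∀ n : ℕ, 1 ≤ n → 0 < (P ^ n) s s → m ∣ n) → m = 1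

/-- The policy gives positive probability to every action in every state, and the
state chain that it induces is irreducible and aperiodic. -/
def IsExploring (M : MDP S A) (π : Policy S A) : Prop :=
  (∀ s a, 0 < π.prob s a) ∧ (stateMatrix M π).IsIrreducible ∧ IsAperiodic (stateMatrix M π)

/-- Total variation distance of two distributions on a finite set. -/
def tvDist (p q : S → ℝ) : ℝ :=
  (1 / 2) * ∑ s, |p s - q s|

/-- The mixing time `t_δ`: the least `k` such that from every starting state the law of the state
chain after `k` steps is within total variation distance `δ` of the stationary distribution. -/
def mixingTime (M : MDP S A) (π : Policy S A) (δ : ℝ) : ℕ :=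
  sInf {k : ℕ | ∀ s, tvDist ((stateMatrix M π ^ k) s) (stationaryDist (stateMatrix M π)) ≤ δ}

/-- The diagonal matrix `D` of the stationary distribution `μ(s) π(a|s)` of the state-action
chain. -/
def weightMatrix (M : MDP S A) (π : Policy S A) : Matrix (S × A) (S × A) ℝ :=
  Matrix.diagonal fun x => stationaryDist (stateMatrix M π) x.1 * π.prob x.1 x.2

/-- The minimum eigenvalue of `Φᵀ D Φ`. -/
def lambdaMin {d : ℕ} (M : MDP S A) (π : Policy S A) (Φ : Matrix (S × A) (Fin d) ℝ) : ℝ :=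
  sInf (spectrum ℝ (Φᵀ * weightMatrix M π * Φ))

end Chains

section Algorithm

variable {S A : Type*} [Fintype S] [Fintype A] [Nonempty A] {d : ℕ}

/-- The iterates `θ_{t,k}` of one run of the inner loop, with target parameter `θhat` and
stepsizes `α k`, along the states `x 0, x 1, …` and actions `u 0, u 1, …`. -/
def innerIter (M : MDP S A) (Φ : Matrix (S × A) (Fin d) ℝ) (α : ℕ → ℝ)
    (x : ℕ → S) (u : ℕ → A) (θhat : Fin d → ℝ) : ℕ → Fin d → ℝ
  | 0 => 0
  | k + 1 =>
    let θ := innerIter M Φ α x u θhat k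
    θ + (α k * (M.R (x k) (u k)
        + M.γ * Finset.univ.sup' Finset.univ_nonempty
            (fun a' : A => Φ (x (k + 1), a') ⬝ᵥ θhat)
        - Φ (x k, u k) ⬝ᵥ θ)) • Φ (x k, u k)

/-- The target network parameters `θhat_t` of Q-learning with target network and without
truncation, run along one trajectory `x, u`: the `t`-th inner loop uses the
samples with time indices `t * K, …, t * K + K`. -/
def targetIter (M : MDP S A) (Φ : Matrix (S × A) (Fin d) ℝ) (α : ℕ → ℝ) (K : ℕ)
    (x : ℕ → S) (u : ℕ → A) : ℕ → Fin d → ℝ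
  | 0 => 0
  | t + 1 =>
    innerIter M Φ α (fun k => x (t * K + k)) (fun k => u (t * K + k))
      (targetIter M Φ α K x u t) K

end Algorithm

/-- The random states `X k` and actions `U k` form a trajectory of the MDP under the policy `π`
(with an arbitrary law of the initial state): `U k` is drawn from `π(· | X k)` and `X (k + 1)` from
`P_{U k}(X k, ·)`. This is expressed through the probabilities of all finite paths. -/
structure IsTrajectory {S A Ω : Type*} [Fintype S] [Fintype A] [MeasurableSpace Ω]
    (M : MDP S A) (π : Policy S A) (ℙ : MeasureTheory.Measure Ω)
    (X : ℕ → Ω → S) (U : ℕ → Ω → A) : Prop where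
  measurable_state : ∀ k s, MeasurableSet {ω | X k ω = s}
  measurable_action : ∀ k a, MeasurableSet {ω | U k ω = a}
  path_prob : ∀ (n : ℕ) (s : ℕ → S) (a : ℕ → A),
    ℙ.real {ω | (∀ i ≤ n, X i ω = s i) ∧ ∀ i < n, U i ω = a i} =
      ℙ.real {ω | X 0 ω = s 0} *
        ∏ i ∈ Finset.range n, (π.prob (s i) (a i) * M.P (a i) (s i) (s (i + 1)))

end TargetQ

end

/-!
Since `Φ` is square with independent columns, the features are a basis: for every target parameter
`h` there is `θ*` with `Φ θ* = optBellman M (Φ h)` exactly. In terms of the error `x = θ - θ*`, an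
inner step on the sample `(s, a, s')` therefore reads
`x' = x + α (w - φ(s, a) · x) φ(s, a)` with the martingale difference
`w = γ (V(s') - ∑ z, P_a(s, z) V(z))`, where `V = max_a (Φ h)(·, a)` (`innerStep_sub`). There is no
Markovian bias to control, only the question whether the drift `-α (φ · x)²` reaches all directions.

Irreducibility and aperiodicity give `N` and `c > 0` with all entries of `P ^ N` at least `c`, so
the expected square of `φ · x` after `N` steps is at least a multiple of `‖x‖²`, whatever the
initial state (`exists_excitation`). The Lyapunov function
`‖x‖² - α ∑_{k < N} E_s (φ(S_k, A_k) · x)²` trades the drift at the current state for the drift after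
`N` steps, because the energy sum telescopes under one transition (`stepMean_energy`). For small `α`
it thus contracts by a factor `1 - α c / 2` per step up to `O(α²)(1 + ‖Φ h‖)²` (`lyapunov_drift`),
so that the mean square error of an inner loop of length `K` is at most
`(exp(-α c K / 2) + O(α)) (1 + ‖Φ h‖)²`.

Since `Q*` is the fixed point of the Bellman operator (`optBellman_qStar`), which is a
`γ`-contraction, one round maps `e = E ‖Φ θhat_t - Q*‖` to at most `(γ + ρ) e + ρ`, with `ρ²` of the
order of `α + exp(-α c K / 2)` (`innerOp_iterate_norm_le`). The error of an inner loop may grow with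
the target parameter, but only relative to it, and this is absorbed by the contraction; no
truncation is needed, and the bound persists for all later rounds. With `α` of order `ε²`, `K` of
order `ε⁻² log(1/ε)` and `T` of order `log(1/ε)` the error is below `ε`. The requirement
`K ≥ t_α + 1` costs nothing: by Doeblin's contraction `t_α = O(1/α)` (`mixingTime_le`).

Expectations along the trajectory enter only through the one-step Markov property
(`IsTrajectory.integral_step`), which turns an inner loop into `K` applications of the transition
operator `innerOp` of the chain of states and parameters (`IsTrajectory.integral_targetIter_succ`).
-/

noncomputable section

namespace TargetQ

/-! ### Primitive chains: stationary law, mixing time, and `λ_min > 0` -/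

section MarkovChain

variable {S : Type*} [Fintype S] [DecidableEq S]

/-- The possible return times of a state generate, by aperiodicity, all large integers; they are
closed under addition, so all large integers are themselves return times. -/
lemma IsAperiodic.eventually_diag_pos {P : Matrix S S ℝ} (hP : ∀ i j, 0 ≤ P i j)
    (ha : IsAperiodic P) (s : S) : ∃ n, ∀ m ≥ n, 0 < (P ^ m) s s := by
  obtain ⟨n, hn⟩ := Nat.exists_mem_closure_of_ge {k : ℕ | 1 ≤ k ∧ 0 < (P ^ k) s s}
  have hg : Nat.setGcd {k : ℕ | 1 ≤ k ∧ 0 < (P ^ k) s s} = 1 :=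
    ha s _ fun k hk hk' => Nat.setGcd_dvd_of_mem ⟨hk, hk'⟩
  refine ⟨n, fun m hm => ?_⟩
  refine AddSubmonoid.closure_induction (motive := fun k _ => 0 < (P ^ k) s s) ?_ ?_ ?_
    (hn m hm (by simp [hg]))
  · exact fun k hk => hk.2
  · simp
  · intro a b _ _ h1 h2
    rw [pow_add, Matrix.mul_apply]
    refine lt_of_lt_of_le (mul_pos h1 h2) ?_
    exact Finset.single_le_sum (f := fun j => (P ^ a) s j * (P ^ b) j s)
      (fun j _ => mul_nonneg (Matrix.pow_apply_nonneg hP a s j) (Matrix.pow_apply_nonneg hP b j s))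
      (Finset.mem_univ s)

/-- An irreducible aperiodic matrix is primitive: a path from `i` to `j` can be padded by returns
to `i` to one common length. -/
lemma exists_pow_pos_of_isAperiodic {P : Matrix S S ℝ} (hirr : P.IsIrreducible)
    (ha : IsAperiodic P) : ∃ N, ∀ i j, 0 < (P ^ N) i j := by
  have hP := hirr.nonneg
  choose n hn using ha.eventually_diag_pos hP
  choose k _ hk using (Matrix.isIrreducible_iff_exists_pow_pos hP).1 hirr
  refine ⟨∑ s, n s + ∑ i, ∑ j, k i j, fun i j => ?_⟩
  have h1 : n i ≤ ∑ s, n s := Finset.single_le_sum (fun _ _ => Nat.zero_le _) (Finset.mem_univ i)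
  have h2 : k i j ≤ ∑ i, ∑ j, k i j :=
    (Finset.single_le_sum (f := fun j => k i j) (fun _ _ => Nat.zero_le _)
      (Finset.mem_univ j)).trans
      (Finset.single_le_sum (f := fun i => ∑ j, k i j) (fun _ _ => Nat.zero_le _)
        (Finset.mem_univ i))
  obtain ⟨r, hr⟩ := Nat.exists_eq_add_of_le h2
  rw [hr, show ∑ s, n s + (k i j + r) = (∑ s, n s + r) + k i j by ring, pow_add,
    Matrix.mul_apply]
  refine lt_of_lt_of_le (mul_pos (hn i (∑ s, n s + r) (by omega)) (hk i j)) ?_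
  exact Finset.single_le_sum (f := fun l => (P ^ (∑ s, n s + r)) i l * (P ^ k i j) l j)
    (fun l _ => mul_nonneg (Matrix.pow_apply_nonneg hP _ _ _) (Matrix.pow_apply_nonneg hP _ _ _))
    (Finset.mem_univ i)

/-- A left eigenvector for the eigenvalue `1` exists because `1` is a right eigenvector; its
entrywise absolute value is subinvariant with the same total mass, hence invariant. -/
lemma exists_isStationary [Nonempty S] {P : Matrix S S ℝ} (hP : P ∈ Matrix.rowStochastic ℝ S) :
    ∃ μ, IsStationary P μ := by
  have hdet : (P - 1).det = 0 := by
    rw [← Matrix.exists_mulVec_eq_zero_iff]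
    refine ⟨1, one_ne_zero, ?_⟩
    rw [Matrix.sub_mulVec, Matrix.one_vecMul_of_mem_rowStochastic hP, Matrix.one_mulVec, sub_self]
  obtain ⟨v, hv0, hv⟩ := Matrix.exists_vecMul_eq_zero_iff.2 hdet
  have hvP : v ᵥ* P = v := by
    rw [Matrix.vecMul_sub, Matrix.vecMul_one] at hv
    exact sub_eq_zero.1 hv
  set u : S → ℝ := fun s => |v s| with hu
  have hle : ∀ s, u s ≤ (u ᵥ* P) s := by
    intro s
    have : v s = ∑ i, v i * P i s := (congrFun hvP s).symm
    calc u s = |∑ i, v i * P i s| := by rw [← this]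
      _ ≤ ∑ i, |v i * P i s| := Finset.abs_sum_le_sum_abs _ _
      _ = (u ᵥ* P) s := by
        refine Finset.sum_congr rfl fun i _ => ?_
        rw [abs_mul, abs_of_nonneg (Matrix.nonneg_of_mem_rowStochastic hP)]
  have hsum : ∑ s, (u ᵥ* P) s = ∑ s, u s := by
    have h : (u ᵥ* P) ⬝ᵥ 1 = u ⬝ᵥ 1 := by
      rw [← Matrix.dotProduct_mulVec, Matrix.one_vecMul_of_mem_rowStochastic hP]
    simpa [dotProduct] using h
  have heq : u ᵥ* P = u := by
    funext s
    exact ((Finset.sum_eq_sum_iff_of_le fun s _ => hle s).1 hsum.symm s (Finset.mem_univ s)).symm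
  have hpos : 0 < ∑ s, u s := by
    obtain ⟨s, hs⟩ := Function.ne_iff.1 hv0
    exact lt_of_lt_of_le (abs_pos.2 hs)
      (Finset.single_le_sum (f := u) (fun i _ => abs_nonneg _) (Finset.mem_univ s))
  refine ⟨(∑ s, u s)⁻¹ • u, fun s => ?_, ?_, ?_⟩
  · exact mul_nonneg (inv_nonneg.2 hpos.le) (abs_nonneg _)
  · simp only [Pi.smul_apply, smul_eq_mul, ← Finset.mul_sum]
    exact inv_mul_cancel₀ hpos.ne'
  · rw [Matrix.smul_vecMul, heq]

lemma IsStationary.vecMul_pow {P : Matrix S S ℝ} {μ : S → ℝ} (h : IsStationary P μ) (n : ℕ) :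
    μ ᵥ* P ^ n = μ := by
  induction n with
  | zero => simp
  | succ n ih => rw [pow_succ, ← Matrix.vecMul_vecMul, ih, h.2.2]

lemma IsStationary.le_of_pow_ge {P : Matrix S S ℝ} {μ : S → ℝ} (h : IsStationary P μ)
    {N : ℕ} {c : ℝ} (hc : ∀ i j, c ≤ (P ^ N) i j) (s : S) : c ≤ μ s := by
  rw [← h.vecMul_pow N]
  calc c = ∑ i, μ i * c := by rw [← Finset.sum_mul, h.2.1, one_mul]
    _ ≤ _ := Finset.sum_le_sum fun i _ => mul_le_mul_of_nonneg_left (hc i s) (h.1 i)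

/-- Doeblin's contraction in `ℓ¹`: a stochastic matrix with all entries at least `c` shrinks
vectors of total mass zero by the factor `1 - c`. -/
lemma sum_abs_vecMul_le [Nonempty S] {Q : Matrix S S ℝ} (hQ : Q ∈ Matrix.rowStochastic ℝ S)
    {c : ℝ} (hc0 : 0 ≤ c) (hc : ∀ i j, c ≤ Q i j) {v : S → ℝ} (hv : ∑ s, v s = 0) :
    ∑ s, |(v ᵥ* Q) s| ≤ (1 - c) * ∑ s, |v s| := by
  have h1 : ∀ s, |(v ᵥ* Q) s| ≤ ∑ i, |v i| * (Q i s - c) := by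
    intro s
    have : (v ᵥ* Q) s = ∑ i, v i * (Q i s - c) := by
      simp only [mul_sub, Finset.sum_sub_distrib, ← Finset.sum_mul, hv, zero_mul, sub_zero]
      rfl
    rw [this]
    refine (Finset.abs_sum_le_sum_abs _ _).trans (le_of_eq (Finset.sum_congr rfl fun i _ => ?_))
    rw [abs_mul, abs_of_nonneg (sub_nonneg.2 (hc i s))]
  calc ∑ s, |(v ᵥ* Q) s| ≤ ∑ s, ∑ i, |v i| * (Q i s - c) := Finset.sum_le_sum fun s _ => h1 s
    _ = ∑ i, |v i| * (1 - Fintype.card S * c) := by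
      rw [Finset.sum_comm]
      refine Finset.sum_congr rfl fun i _ => ?_
      rw [← Finset.mul_sum, Finset.sum_sub_distrib, Matrix.sum_row_of_mem_rowStochastic hQ]
      simp
    _ ≤ ∑ i, |v i| * (1 - c) := by
      refine Finset.sum_le_sum fun i _ => mul_le_mul_of_nonneg_left ?_ (abs_nonneg _)
      have : (1 : ℝ) ≤ Fintype.card S := by exact_mod_cast Fintype.card_pos
      nlinarith
    _ = _ := by rw [← Finset.sum_mul, mul_comm]

lemma tvDist_pow_le [Nonempty S] {P : Matrix S S ℝ} (hP : P ∈ Matrix.rowStochastic ℝ S)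
    {μ : S → ℝ} (hμ : IsStationary P μ) {N : ℕ} {c : ℝ} (hc0 : 0 ≤ c) (hc1 : c ≤ 1)
    (hc : ∀ i j, c ≤ (P ^ N) i j) (k : ℕ) (s : S) :
    tvDist ((P ^ (N * k)) s) μ ≤ (1 - c) ^ k := by
  have hsum : ∀ n, ∑ j, (P ^ n) s j = 1 := fun n =>
    Matrix.sum_row_of_mem_rowStochastic (pow_mem hP n) s
  have hrow : ∀ n m, (P ^ (n + m)) s = (P ^ n) s ᵥ* P ^ m := by
    intro n m; funext j; rw [pow_add, Matrix.mul_apply]; rfl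
  have key : ∑ j, |((P ^ (N * k)) s - μ) j| ≤ (1 - c) ^ k * 2 := by
    induction k with
    | zero =>
      calc ∑ j, |((P ^ (N * 0)) s - μ) j| ≤ ∑ j, ((P ^ 0) s j + μ j) := by
            refine Finset.sum_le_sum fun j _ => ?_
            refine (abs_sub _ _).trans (le_of_eq ?_)
            rw [abs_of_nonneg (hμ.1 j), abs_of_nonneg]; rfl
            exact Matrix.nonneg_of_mem_rowStochastic (pow_mem hP _)
        _ = _ := by rw [Finset.sum_add_distrib, hsum, hμ.2.1]; norm_num
    | succ k ih =>
      have : (P ^ (N * (k + 1))) s - μ = ((P ^ (N * k)) s - μ) ᵥ* P ^ N := by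
        rw [Matrix.sub_vecMul, hμ.vecMul_pow, ← hrow, mul_add, mul_one]
      rw [this]
      refine (sum_abs_vecMul_le (pow_mem hP N) hc0 hc ?_).trans ?_
      · simp [Finset.sum_sub_distrib, hsum, hμ.2.1]
      · rw [pow_succ']
        nlinarith
  unfold tvDist
  have : ∑ j, |(P ^ (N * k)) s j - μ j| ≤ (1 - c) ^ k * 2 := key
  linarith

/-- By Bernoulli's inequality. -/
lemma one_sub_pow_le_inv {c : ℝ} (hc0 : 0 ≤ c) (hc1 : c ≤ 1) (k : ℕ) :
    (1 - c) ^ k * (1 + k * c) ≤ 1 := by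
  have h1 : 1 + k * c ≤ (1 + c) ^ k := one_add_mul_le_pow (by linarith) k
  calc (1 - c) ^ k * (1 + k * c) ≤ (1 - c) ^ k * (1 + c) ^ k :=
        mul_le_mul_of_nonneg_left h1 (pow_nonneg (by linarith) k)
    _ = (1 - c ^ 2) ^ k := by rw [← mul_pow]; ring
    _ ≤ 1 := pow_le_one₀ (by nlinarith) (by nlinarith)

variable {A : Type*} [Fintype A]

lemma stateMatrix_mem_rowStochastic (M : MDP S A) (π : Policy S A) :
    stateMatrix M π ∈ Matrix.rowStochastic ℝ S := by
  rw [Matrix.mem_rowStochastic_iff_sum]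
  refine ⟨fun i j => Finset.sum_nonneg fun a _ => mul_nonneg (π.nonneg i a) (M.P_nonneg a i j),
    fun i => ?_⟩
  simp only [stateMatrix, Matrix.of_apply]
  rw [Finset.sum_comm]
  simp [← Finset.mul_sum, M.P_sum, π.sum_eq_one]

lemma isStationary_stationaryDist [Nonempty S] (M : MDP S A) (π : Policy S A) :
    IsStationary (stateMatrix M π) (stationaryDist (stateMatrix M π)) :=
  Classical.epsilon_spec (exists_isStationary (stateMatrix_mem_rowStochastic M π))

lemma IsExploring.exists_pow_ge [Nonempty S] {M : MDP S A} {π : Policy S A}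
    (h : IsExploring M π) :
    ∃ (N : ℕ) (c : ℝ), 0 < c ∧ c ≤ 1 ∧ ∀ i j, c ≤ (stateMatrix M π ^ N) i j := by
  obtain ⟨N, hN⟩ := exists_pow_pos_of_isAperiodic h.2.1 h.2.2
  obtain ⟨x, hx⟩ := Finite.exists_min fun x : S × S => (stateMatrix M π ^ N) x.1 x.2
  exact ⟨N, _, hN x.1 x.2, Matrix.le_one_of_mem_rowStochastic
    (pow_mem (stateMatrix_mem_rowStochastic M π) N), fun i j => hx (i, j)⟩

/-- Geometric mixing at rate `1 - c` per `N` steps implies `t_δ = O(1/δ)`, which is all that is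
needed here. -/
lemma mixingTime_le [Nonempty S] {M : MDP S A} {π : Policy S A} {N : ℕ} {c : ℝ}
    (hc0 : 0 < c) (hc1 : c ≤ 1) (hc : ∀ i j, c ≤ (stateMatrix M π ^ N) i j)
    {δ : ℝ} (hδ : 0 < δ) : mixingTime M π δ ≤ N * ⌈1 / (c * δ)⌉₊ := by
  refine Nat.sInf_le fun s => ?_
  refine (tvDist_pow_le (stateMatrix_mem_rowStochastic M π) (isStationary_stationaryDist M π)
    hc0.le hc1 hc _ s).trans ?_
  set k := ⌈1 / (c * δ)⌉₊
  have hk : 1 / (c * δ) ≤ k := Nat.le_ceil _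
  rw [div_le_iff₀ (by positivity)] at hk
  have h := one_sub_pow_le_inv hc0.le hc1 k
  have hp : 0 ≤ (1 - c) ^ k := pow_nonneg (by linarith) k
  have h2 : (1 - c) ^ k * (k * c) ≤ 1 := by nlinarith
  nlinarith [mul_le_mul_of_nonneg_left hk hp]

lemma lambdaMin_pos [DecidableEq A] [Nonempty S] [Nonempty A] {M : MDP S A} {π : Policy S A}
    (h : IsExploring M π) {d : ℕ} [NeZero d] {Φ : Matrix (S × A) (Fin d) ℝ}
    (hΦ : Function.Injective Φ.mulVec) : 0 < lambdaMin M π Φ := by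
  obtain ⟨N, c, hc0, -, hc⟩ := h.exists_pow_ge
  have hD : (weightMatrix M π).PosDef := by
    rw [weightMatrix, Matrix.posDef_diagonal_iff]
    exact fun x => mul_pos (hc0.trans_le
      ((isStationary_stationaryDist M π).le_of_pow_ge hc x.1)) (h.1 x.1 x.2)
  have hpd : (Φᵀ * weightMatrix M π * Φ).PosDef := by
    rw [← Matrix.conjTranspose_eq_transpose_of_trivial]
    exact hD.conjTranspose_mul_mul_same hΦ
  rw [lambdaMin, hpd.1.spectrum_real_eq_range_eigenvalues]
  obtain ⟨i, hi⟩ := (Set.range_nonempty hpd.1.eigenvalues).csInf_mem (Set.finite_range _)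
  rw [← hi]
  exact hpd.eigenvalues_pos i

end MarkovChain

/-! ### The Bellman optimality equation -/

section Bellman

variable {S A : Type*} [Fintype S] [Fintype A] [Nonempty A]

/-- The greedy value `s ↦ max_a Q(s, a)` of a state-action function. -/
def maxVal (Q : S × A → ℝ) (s : S) : ℝ :=
  Finset.univ.sup' Finset.univ_nonempty fun a => Q (s, a)

/-- The Bellman optimality operator. -/
def optBellman (M : MDP S A) (Q : S × A → ℝ) (x : S × A) : ℝ :=
  M.R x.1 x.2 + M.γ * ∑ s', M.P x.2 x.1 s' * maxVal Q s'

omit [Fintype S] in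
lemma le_maxVal (Q : S × A → ℝ) (s : S) (a : A) : Q (s, a) ≤ maxVal Q s :=
  Finset.le_sup' (fun a => Q (s, a)) (Finset.mem_univ a)

omit [Fintype S] in
lemma exists_eq_maxVal (Q : S × A → ℝ) (s : S) : ∃ a, maxVal Q s = Q (s, a) := by
  obtain ⟨a, -, ha⟩ := Finset.exists_mem_eq_sup' Finset.univ_nonempty fun a => Q (s, a)
  exact ⟨a, ha⟩

lemma abs_maxVal_sub_le (Q Q' : S × A → ℝ) (s : S) : |maxVal Q s - maxVal Q' s| ≤ ‖Q - Q'‖ := by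
  have h : ∀ Q Q' : S × A → ℝ, maxVal Q s - maxVal Q' s ≤ ‖Q - Q'‖ := by
    intro Q Q'
    obtain ⟨a, ha⟩ := exists_eq_maxVal Q s
    have h1 := le_maxVal Q' s a
    have h2 := (le_abs_self _).trans (norm_le_pi_norm (Q - Q') (s, a))
    simp only [Pi.sub_apply] at h2
    linarith
  rw [abs_le]
  have := h Q' Q
  rw [norm_sub_rev] at this
  exact ⟨by linarith, h Q Q'⟩

lemma abs_maxVal_le (Q : S × A → ℝ) (s : S) : |maxVal Q s| ≤ ‖Q‖ := by
  obtain ⟨a, ha⟩ := exists_eq_maxVal Q s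
  rw [ha]
  exact norm_le_pi_norm Q (s, a)

omit [Fintype A] [Nonempty A] in
lemma abs_transition_sum_le (M : MDP S A) (x : S × A) {V : S → ℝ} {b : ℝ}
    (hV : ∀ s, |V s| ≤ b) : |∑ s', M.P x.2 x.1 s' * V s'| ≤ b := by
  calc |∑ s', M.P x.2 x.1 s' * V s'| ≤ ∑ s', |M.P x.2 x.1 s' * V s'| :=
        Finset.abs_sum_le_sum_abs _ _
    _ ≤ ∑ s', M.P x.2 x.1 s' * b := Finset.sum_le_sum fun s' _ => by
        rw [abs_mul, abs_of_nonneg (M.P_nonneg _ _ _)]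
        exact mul_le_mul_of_nonneg_left (hV s') (M.P_nonneg _ _ _)
    _ = b := by rw [← Finset.sum_mul, M.P_sum, one_mul]

lemma norm_optBellman_sub_le (M : MDP S A) (Q Q' : S × A → ℝ) :
    ‖optBellman M Q - optBellman M Q'‖ ≤ M.γ * ‖Q - Q'‖ := by
  refine (pi_norm_le_iff_of_nonneg (mul_nonneg M.γ_pos.le (norm_nonneg _))).2 fun x => ?_
  have : (optBellman M Q - optBellman M Q') x =
      M.γ * ∑ s', M.P x.2 x.1 s' * (maxVal Q s' - maxVal Q' s') := by
    simp only [Pi.sub_apply, optBellman, mul_sub, Finset.sum_sub_distrib]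
    ring
  rw [this, Real.norm_eq_abs, abs_mul, abs_of_pos M.γ_pos]
  exact mul_le_mul_of_nonneg_left (abs_transition_sum_le M x fun s => abs_maxVal_sub_le Q Q' s)
    M.γ_pos.le

lemma norm_optBellman_le (M : MDP S A) (Q : S × A → ℝ) : ‖optBellman M Q‖ ≤ 1 + ‖Q‖ := by
  refine (pi_norm_le_iff_of_nonneg (by positivity)).2 fun x => ?_
  have h1 := abs_transition_sum_le M x (abs_maxVal_le Q)
  have h2 : |M.R x.1 x.2| ≤ 1 := by
    rw [abs_of_nonneg (M.R_nonneg _ _)]; exact M.R_le_one _ _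
  refine (abs_add_le _ _).trans (add_le_add h2 ?_)
  rw [abs_mul, abs_of_pos M.γ_pos]
  exact (mul_le_mul M.γ_lt_one.le h1 (abs_nonneg _) zero_le_one).trans_eq (one_mul _)

lemma exists_optBellman_fixedPoint (M : MDP S A) : ∃ Q, optBellman M Q = Q := by
  have hc : ContractingWith ⟨M.γ, M.γ_pos.le⟩ (optBellman M) := by
    refine ⟨by exact_mod_cast M.γ_lt_one, LipschitzWith.of_dist_le_mul fun Q Q' => ?_⟩
    rw [dist_eq_norm, dist_eq_norm]
    exact norm_optBellman_sub_le M Q Q'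
  exact ⟨_, hc.fixedPoint_isFixedPt⟩

variable [DecidableEq S] [DecidableEq A]

omit [Nonempty A] [DecidableEq S] [DecidableEq A] in
lemma stateActionMatrix_sum (M : MDP S A) (π : Policy S A) (x : S × A) (f : S × A → ℝ) :
    (stateActionMatrix M π *ᵥ f) x = ∑ s', M.P x.2 x.1 s' * ∑ a', π.prob s' a' * f (s', a') := by
  simp only [Matrix.mulVec, dotProduct, stateActionMatrix, Matrix.of_apply,
    Fintype.sum_prod_type, Finset.mul_sum, mul_assoc]

omit [Nonempty A] in
lemma stateActionMatrix_mem_rowStochastic (M : MDP S A) (π : Policy S A) :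
    stateActionMatrix M π ∈ Matrix.rowStochastic ℝ (S × A) := by
  rw [Matrix.mem_rowStochastic_iff_sum]
  refine ⟨fun x y => mul_nonneg (M.P_nonneg _ _ _) (π.nonneg _ _), fun x => ?_⟩
  have := stateActionMatrix_sum M π x fun _ => 1
  simpa [Matrix.mulVec, dotProduct, π.sum_eq_one, M.P_sum] using this

omit [Nonempty A] in
lemma abs_mulVec_reward_le (M : MDP S A) (π : Policy S A) (k : ℕ) (x : S × A) :
    |((stateActionMatrix M π ^ k) *ᵥ fun y => M.R y.1 y.2) x| ≤ 1 := by
  have hW := pow_mem (stateActionMatrix_mem_rowStochastic M π) k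
  have h0 : 0 ≤ ((stateActionMatrix M π ^ k) *ᵥ fun y => M.R y.1 y.2) x :=
    Finset.sum_nonneg fun y _ =>
      mul_nonneg (Matrix.nonneg_of_mem_rowStochastic hW) (M.R_nonneg _ _)
  rw [abs_of_nonneg h0, ← Matrix.sum_row_of_mem_rowStochastic hW x]
  exact Finset.sum_le_sum fun y _ =>
    mul_le_of_le_one_right (Matrix.nonneg_of_mem_rowStochastic hW) (M.R_le_one _ _)

omit [Nonempty A] in
lemma summable_qPolicy (M : MDP S A) (π : Policy S A) (x : S × A) :
    Summable fun k : ℕ =>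
      M.γ ^ k * ((stateActionMatrix M π ^ k) *ᵥ fun y => M.R y.1 y.2) x := by
  refine Summable.of_norm_bounded (summable_geometric_of_lt_one M.γ_pos.le M.γ_lt_one)
    fun k => ?_
  rw [Real.norm_eq_abs, abs_mul, abs_of_nonneg (pow_nonneg M.γ_pos.le k)]
  exact mul_le_of_le_one_right (pow_nonneg M.γ_pos.le k) (abs_mulVec_reward_le M π k x)

omit [Nonempty A] in
/-- The Bellman equation of a fixed policy. -/
lemma qPolicy_eq (M : MDP S A) (π : Policy S A) (x : S × A) :
    qPolicy M π x = M.R x.1 x.2 + M.γ * (stateActionMatrix M π *ᵥ qPolicy M π) x := by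
  have hs := summable_qPolicy M π
  rw [qPolicy, (hs x).tsum_eq_zero_add]
  congr 1
  · simp
  · have hsum : (stateActionMatrix M π *ᵥ qPolicy M π) x = ∑ y, stateActionMatrix M π x y *
        ∑' k : ℕ, M.γ ^ k * ((stateActionMatrix M π ^ k) *ᵥ fun y => M.R y.1 y.2) y := rfl
    rw [hsum]
    simp_rw [← tsum_mul_left]
    rw [← Summable.tsum_finsetSum fun y _ => ((hs y).mul_left _), ← tsum_mul_left]
    refine tsum_congr fun k => ?_
    rw [pow_succ' (stateActionMatrix M π), ← Matrix.mulVec_mulVec]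
    rw [Matrix.mulVec, dotProduct, Finset.mul_sum, Finset.mul_sum]
    refine Finset.sum_congr rfl fun y _ => ?_
    ring

omit [Nonempty A] in
/-- A maximum principle: a function that is dominated by its discounted average has no positive
maximum. -/
lemma nonpos_of_le_discounted (M : MDP S A) (π : Policy S A) {D : S × A → ℝ}
    (hD : ∀ x, D x ≤ M.γ * (stateActionMatrix M π *ᵥ D) x) (x : S × A) : D x ≤ 0 := by
  have : Nonempty (S × A) := ⟨x⟩
  obtain ⟨x₀, hx₀⟩ := Finite.exists_max D
  have hW := stateActionMatrix_mem_rowStochastic M π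
  have h1 : (stateActionMatrix M π *ᵥ D) x₀ ≤ D x₀ := by
    calc (stateActionMatrix M π *ᵥ D) x₀ ≤ ∑ y, stateActionMatrix M π x₀ y * D x₀ :=
          Finset.sum_le_sum fun y _ =>
            mul_le_mul_of_nonneg_left (hx₀ y) (Matrix.nonneg_of_mem_rowStochastic hW)
      _ = D x₀ := by rw [← Finset.sum_mul, Matrix.sum_row_of_mem_rowStochastic hW, one_mul]
  have h2 := hD x₀
  have h3 : D x₀ ≤ 0 := by nlinarith [M.γ_pos, M.γ_lt_one]
  exact (hx₀ x).trans h3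

/-- A fixed point of the Bellman operator dominates every policy value and is the value of its
greedy policy. -/
lemma qStar_eq_of_fixedPoint [Nonempty S] {M : MDP S A} {Q : S × A → ℝ} (hQ : optBellman M Q = Q) :
    qStar M = Q := by
  have hle : ∀ (π : Policy S A) x, qPolicy M π x ≤ Q x := by
    intro π x
    refine sub_nonpos.1 (nonpos_of_le_discounted M π (D := fun x => qPolicy M π x - Q x)
      (fun x => ?_) x)
    have hQx : Q x = optBellman M Q x := by rw [hQ]
    have h1 : (stateActionMatrix M π *ᵥ Q) x ≤ ∑ s', M.P x.2 x.1 s' * maxVal Q s' := by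
      rw [stateActionMatrix_sum]
      refine Finset.sum_le_sum fun s' _ => mul_le_mul_of_nonneg_left ?_ (M.P_nonneg _ _ _)
      calc ∑ a', π.prob s' a' * Q (s', a') ≤ ∑ a', π.prob s' a' * maxVal Q s' :=
            Finset.sum_le_sum fun a' _ =>
              mul_le_mul_of_nonneg_left (le_maxVal Q s' a') (π.nonneg _ _)
        _ = maxVal Q s' := by rw [← Finset.sum_mul, π.sum_eq_one, one_mul]
    have h2 : (stateActionMatrix M π *ᵥ fun x => qPolicy M π x - Q x) x =
        (stateActionMatrix M π *ᵥ qPolicy M π) x - (stateActionMatrix M π *ᵥ Q) x := by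
      rw [← Pi.sub_apply, ← Matrix.mulVec_sub]; rfl
    rw [h2, qPolicy_eq, hQx, optBellman]
    have := mul_le_mul_of_nonneg_left h1 M.γ_pos.le
    linarith
  -- `g` is a greedy action, and `π` the deterministic policy that takes it.
  choose g hg using exists_eq_maxVal Q
  let π : Policy S A :=
    { prob := fun s a => if a = g s then 1 else 0
      nonneg := fun s a => by split_ifs <;> norm_num
      sum_eq_one := fun s => by simp }
  have hge : ∀ x, Q x ≤ qPolicy M π x := by
    intro x
    refine sub_nonpos.1 (nonpos_of_le_discounted M π (D := fun x => Q x - qPolicy M π x)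
      (fun x => le_of_eq ?_) x)
    have hQx : Q x = optBellman M Q x := by rw [hQ]
    have h1 : (stateActionMatrix M π *ᵥ Q) x = ∑ s', M.P x.2 x.1 s' * maxVal Q s' := by
      rw [stateActionMatrix_sum]
      refine Finset.sum_congr rfl fun s' _ => ?_
      simp [π, hg]
    have h2 : (stateActionMatrix M π *ᵥ fun x => Q x - qPolicy M π x) x =
        (stateActionMatrix M π *ᵥ Q) x - (stateActionMatrix M π *ᵥ qPolicy M π) x := by
      rw [← Pi.sub_apply, ← Matrix.mulVec_sub]; rfl
    rw [h2, h1, qPolicy_eq, hQx, optBellman]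
    ring
  have : Nonempty (Policy S A) := ⟨π⟩
  funext x
  exact le_antisymm (ciSup_le fun π => hle π x)
    (le_ciSup_of_le ⟨Q x, by rintro _ ⟨π, rfl⟩; exact hle π x⟩ π (hge x))

lemma optBellman_qStar [Nonempty S] (M : MDP S A) : optBellman M (qStar M) = qStar M := by
  obtain ⟨Q, hQ⟩ := exists_optBellman_fixedPoint M
  rw [qStar_eq_of_fixedPoint hQ, hQ]

end Bellman

/-! ### Expectation over one transition -/

section StepMean

variable {S A : Type*} [Fintype S] [Fintype A]

/-- The conditional expectation of `F(Aₖ, Sₖ₊₁)` given `Sₖ = s`. -/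
def stepMean (M : MDP S A) (π : Policy S A) (s : S) (F : A → S → ℝ) : ℝ :=
  ∑ a, π.prob s a * ∑ s', M.P a s s' * F a s'

variable (M : MDP S A) (π : Policy S A) (s : S)

lemma stepMean_mono {F G : A → S → ℝ} (h : ∀ a s', F a s' ≤ G a s') :
    stepMean M π s F ≤ stepMean M π s G :=
  Finset.sum_le_sum fun a _ => mul_le_mul_of_nonneg_left
    (Finset.sum_le_sum fun s' _ => mul_le_mul_of_nonneg_left (h a s') (M.P_nonneg _ _ _))
    (π.nonneg _ _)

lemma stepMean_action (u : A → ℝ) :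
    stepMean M π s (fun a _ => u a) = ∑ a, π.prob s a * u a := by
  simp only [stepMean, ← Finset.sum_mul, M.P_sum, one_mul]

lemma stepMean_const (c : ℝ) : stepMean M π s (fun _ _ => c) = c := by
  rw [stepMean_action, ← Finset.sum_mul, π.sum_eq_one, one_mul]

lemma stepMean_add (F G : A → S → ℝ) :
    stepMean M π s (fun a s' => F a s' + G a s') = stepMean M π s F + stepMean M π s G := by
  simp only [stepMean, mul_add, Finset.sum_add_distrib]

lemma stepMean_const_mul (c : ℝ) (F : A → S → ℝ) :
    stepMean M π s (fun a s' => c * F a s') = c * stepMean M π s F := by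
  simp only [stepMean, Finset.mul_sum]
  exact Finset.sum_congr rfl fun a _ => Finset.sum_congr rfl fun s' _ => by ring

lemma stepMean_state (V : S → ℝ) :
    stepMean M π s (fun _ s' => V s') = (stateMatrix M π *ᵥ V) s := by
  simp only [stepMean, Matrix.mulVec, dotProduct, stateMatrix, Matrix.of_apply, Finset.sum_mul,
    Finset.mul_sum]
  rw [Finset.sum_comm]
  exact Finset.sum_congr rfl fun a _ => Finset.sum_congr rfl fun s' _ => by ring

lemma stepMean_martingale (u : A → ℝ) (V : S → ℝ) :
    stepMean M π s (fun a s' => u a * (V s' - ∑ z, M.P a s z * V z)) = 0 := by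
  refine Finset.sum_eq_zero fun a _ => ?_
  have : ∑ s', M.P a s s' * (u a * (V s' - ∑ z, M.P a s z * V z)) =
      u a * (∑ s', M.P a s s' * V s' - (∑ s', M.P a s s') * ∑ z, M.P a s z * V z) := by
    rw [mul_sub, Finset.sum_mul, Finset.mul_sum, Finset.mul_sum, ← Finset.sum_sub_distrib]
    exact Finset.sum_congr rfl fun s' _ => by ring
  rw [this, M.P_sum, one_mul, sub_self, mul_zero, mul_zero]

end StepMean

/-! ### The transition operator of the inner loop -/

section InnerLoop

variable {S A : Type*} [Fintype S] [Fintype A] [Nonempty A] {d : ℕ}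

/-- One update of the inner loop from the parameter `θ`, with target parameter `h`, on the
sample `(s, a, s')`. -/
def innerStep (M : MDP S A) (Φ : Matrix (S × A) (Fin d) ℝ) (α : ℝ) (h : Fin d → ℝ)
    (s : S) (a : A) (s' : S) (θ : Fin d → ℝ) : Fin d → ℝ :=
  θ + (α * (M.R s a + M.γ * maxVal (Φ *ᵥ h) s' - Φ (s, a) ⬝ᵥ θ)) • Φ (s, a)

/-- The transition operator of the Markov chain `(Sₖ, θₖ)` formed by the state and the parameter
of the inner loop with target parameter `h`. -/
def innerOp (M : MDP S A) (π : Policy S A) (Φ : Matrix (S × A) (Fin d) ℝ) (α : ℝ)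
    (h : Fin d → ℝ) (f : S → (Fin d → ℝ) → ℝ) : S → (Fin d → ℝ) → ℝ :=
  fun s θ => stepMean M π s fun a s' => f s' (innerStep M Φ α h s a s' θ)

variable (M : MDP S A) (π : Policy S A) (Φ : Matrix (S × A) (Fin d) ℝ) (α : ℝ) (h : Fin d → ℝ)

lemma innerOp_iterate_mono (K : ℕ) {f g : S → (Fin d → ℝ) → ℝ} (hfg : ∀ s θ, f s θ ≤ g s θ) :
    ∀ s θ, (innerOp M π Φ α h)^[K] f s θ ≤ (innerOp M π Φ α h)^[K] g s θ := by
  induction K generalizing f g with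
  | zero => exact hfg
  | succ K ih => exact ih fun s θ => stepMean_mono M π s fun a s' => hfg _ _

lemma innerOp_iterate_affine (K : ℕ) (f : S → (Fin d → ℝ) → ℝ) (b c : ℝ) (s : S)
    (θ : Fin d → ℝ) :
    (innerOp M π Φ α h)^[K] (fun s θ => b + c * f s θ) s θ =
      b + c * (innerOp M π Φ α h)^[K] f s θ := by
  induction K generalizing f with
  | zero => rfl
  | succ K ih =>
    rw [Function.iterate_succ_apply, Function.iterate_succ_apply, ← ih]
    have hstep : innerOp M π Φ α h (fun s θ => b + c * f s θ) =
        fun s θ => b + c * innerOp M π Φ α h f s θ := by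
      funext s θ
      simp only [innerOp, stepMean_add, stepMean_const, stepMean_const_mul]
    rw [hstep]

/-- A drift inequality `L ψ ≤ (1 - q) ψ + b` iterates to a geometric decay up to the floor
`b / q`. -/
lemma innerOp_iterate_le_of_drift {ψ : S → (Fin d → ℝ) → ℝ} {q b : ℝ} (hq0 : 0 < q)
    (hq1 : q ≤ 1) (hψ : ∀ s θ, innerOp M π Φ α h ψ s θ ≤ b + (1 - q) * ψ s θ)
    (K : ℕ) (s : S) (θ : Fin d → ℝ) :
    (innerOp M π Φ α h)^[K] ψ s θ ≤ (1 - q) ^ K * ψ s θ + (b / q) * (1 - (1 - q) ^ K) := by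
  induction K with
  | zero => simp
  | succ K ih =>
    rw [Function.iterate_succ_apply]
    refine (innerOp_iterate_mono M π Φ α h K hψ s θ).trans ?_
    rw [innerOp_iterate_affine]
    refine (add_le_add_right (mul_le_mul_of_nonneg_left ih (sub_nonneg.2 hq1)) b).trans
      (le_of_eq ?_)
    field_simp
    ring

end InnerLoop

/-! ### The Lyapunov function of the inner loop -/

section Lyapunov

variable {S A : Type*} [Fintype S] [Fintype A] [DecidableEq S] {d : ℕ}

omit [Fintype S] [Fintype A] [DecidableEq S] in
lemma dotProduct_sq_le (u v : Fin d → ℝ) : (u ⬝ᵥ v) ^ 2 ≤ (u ⬝ᵥ u) * (v ⬝ᵥ v) := by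
  have := Finset.sum_mul_sq_le_sq_mul_sq Finset.univ u v
  simpa [dotProduct, pow_two] using this

omit [Fintype S] [Fintype A] [DecidableEq S] in
lemma dotProduct_self_le_one_of_l1 {u : Fin d → ℝ} (hu : ∑ i, |u i| ≤ 1) : u ⬝ᵥ u ≤ 1 := by
  refine (Finset.sum_le_sum fun i _ => ?_).trans hu
  have h1 : |u i| ≤ 1 :=
    (Finset.single_le_sum (fun j _ => abs_nonneg (u j)) (Finset.mem_univ i)).trans hu
  rw [← abs_mul_abs_self]
  exact mul_le_of_le_one_left (abs_nonneg _) h1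

/-- The expected energy `∑ₖ (φ(Sₖ, Aₖ) · x)²` over the first `N` steps of the chain started at
`s`. -/
def energy (M : MDP S A) (π : Policy S A) (Φ : Matrix (S × A) (Fin d) ℝ) (N : ℕ) (s : S)
    (x : Fin d → ℝ) : ℝ :=
  ∑ k ∈ Finset.range N, ∑ y : S × A,
    (stateMatrix M π ^ k) s y.1 * π.prob y.1 y.2 * (Φ y ⬝ᵥ x) ^ 2

/-- The Lyapunov function of the inner loop in terms of the error `x = θ - θ*`. The correction
by the energy of the next `N` steps turns the drift at the current state into the average drift
after `N` steps. -/
def lyapunov (M : MDP S A) (π : Policy S A) (Φ : Matrix (S × A) (Fin d) ℝ) (α : ℝ) (N : ℕ)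
    (s : S) (x : Fin d → ℝ) : ℝ :=
  x ⬝ᵥ x - α * energy M π Φ N s x

variable {M : MDP S A} {π : Policy S A} {Φ : Matrix (S × A) (Fin d) ℝ}

omit [Fintype S] [Fintype A] [DecidableEq S] in
lemma feature_sq_le (hΦ : ∀ y : S × A, ∑ i, |Φ y i| ≤ 1) (y : S × A) (x : Fin d → ℝ) :
    (Φ y ⬝ᵥ x) ^ 2 ≤ x ⬝ᵥ x := by
  have hx : 0 ≤ x ⬝ᵥ x := Finset.sum_nonneg fun i _ => mul_self_nonneg _
  exact (dotProduct_sq_le _ _).trans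
    (mul_le_of_le_one_left hx (dotProduct_self_le_one_of_l1 (hΦ y)))

lemma law_nonneg (k : ℕ) (s : S) (y : S × A) :
    0 ≤ (stateMatrix M π ^ k) s y.1 * π.prob y.1 y.2 :=
  mul_nonneg (Matrix.nonneg_of_mem_rowStochastic
    (pow_mem (stateMatrix_mem_rowStochastic M π) k)) (π.nonneg _ _)

lemma law_sum (k : ℕ) (s : S) :
    ∑ y : S × A, (stateMatrix M π ^ k) s y.1 * π.prob y.1 y.2 = 1 := by
  rw [Fintype.sum_prod_type]
  simp only [← Finset.mul_sum, π.sum_eq_one, mul_one]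
  exact Matrix.sum_row_of_mem_rowStochastic (pow_mem (stateMatrix_mem_rowStochastic M π) k) s

lemma energy_nonneg (N : ℕ) (s : S) (x : Fin d → ℝ) : 0 ≤ energy M π Φ N s x :=
  Finset.sum_nonneg fun _ _ => Finset.sum_nonneg fun _ _ =>
    mul_nonneg (law_nonneg _ _ _) (sq_nonneg _)

lemma energy_le (hΦ : ∀ y : S × A, ∑ i, |Φ y i| ≤ 1) (N : ℕ) (s : S) (x : Fin d → ℝ) :
    energy M π Φ N s x ≤ N * (x ⬝ᵥ x) := by
  calc energy M π Φ N s x ≤ ∑ k ∈ Finset.range N, ∑ y : S × A,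
        (stateMatrix M π ^ k) s y.1 * π.prob y.1 y.2 * (x ⬝ᵥ x) :=
        Finset.sum_le_sum fun k _ => Finset.sum_le_sum fun y _ =>
          mul_le_mul_of_nonneg_left (feature_sq_le hΦ y x) (law_nonneg k s y)
    _ = N * (x ⬝ᵥ x) := by
        simp only [← Finset.sum_mul, law_sum]
        simp

/-- A move of the error changes the energy by at most `N` times the largest change of a
single square. -/
lemma energy_sub_le {N : ℕ} {s : S} {x x' : Fin d → ℝ} {b : ℝ}
    (hb : ∀ y : S × A, (Φ y ⬝ᵥ x) ^ 2 - b ≤ (Φ y ⬝ᵥ x') ^ 2) :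
    energy M π Φ N s x - N * b ≤ energy M π Φ N s x' := by
  calc energy M π Φ N s x - N * b = ∑ k ∈ Finset.range N, ∑ y : S × A,
        (stateMatrix M π ^ k) s y.1 * π.prob y.1 y.2 * ((Φ y ⬝ᵥ x) ^ 2 - b) := by
        simp only [mul_sub, Finset.sum_sub_distrib, ← Finset.sum_mul, law_sum]
        simp [energy]
    _ ≤ _ := Finset.sum_le_sum fun k _ => Finset.sum_le_sum fun y _ =>
          mul_le_mul_of_nonneg_left (hb y) (law_nonneg k s y)

/-- One transition telescopes the energy. -/
lemma stepMean_energy (N : ℕ) (s : S) (x : Fin d → ℝ) :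
    stepMean M π s (fun _ s' => energy M π Φ N s' x) =
      energy M π Φ N s x - ∑ a, π.prob s a * (Φ (s, a) ⬝ᵥ x) ^ 2 +
        ∑ y : S × A, (stateMatrix M π ^ N) s y.1 * π.prob y.1 y.2 * (Φ y ⬝ᵥ x) ^ 2 := by
  set e : ℕ → ℝ := fun k => ∑ y : S × A,
    (stateMatrix M π ^ k) s y.1 * π.prob y.1 y.2 * (Φ y ⬝ᵥ x) ^ 2 with he
  have h0 : e 0 = ∑ a, π.prob s a * (Φ (s, a) ⬝ᵥ x) ^ 2 := by
    simp [he, Fintype.sum_prod_type, Matrix.one_apply]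
  have hshift : stepMean M π s (fun _ s' => energy M π Φ N s' x) =
      ∑ k ∈ Finset.range N, e (k + 1) := by
    have hmul : stepMean M π s (fun _ s' => energy M π Φ N s' x) =
        ∑ z, stateMatrix M π s z * energy M π Φ N z x := stepMean_state M π s _
    rw [hmul]
    simp only [energy, Finset.mul_sum]
    rw [Finset.sum_comm]
    refine Finset.sum_congr rfl fun k _ => ?_
    rw [Finset.sum_comm]
    refine Finset.sum_congr rfl fun y _ => ?_
    rw [pow_succ' (stateMatrix M π), Matrix.mul_apply, Finset.sum_mul, Finset.sum_mul]
    exact Finset.sum_congr rfl fun z _ => by ring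
  have h1 := Finset.sum_range_succ e N
  rw [Finset.sum_range_succ'] at h1
  rw [hshift, ← h0]
  change _ = ∑ k ∈ Finset.range N, e k - e 0 + e N
  linarith

variable [Nonempty A]

omit [DecidableEq S] in
/-- The error recursion: since the features are a basis, the target `θ*` reproduces the Bellman
update exactly, and the remaining noise is the martingale difference of the greedy value. -/
lemma innerStep_sub {h θs : Fin d → ℝ} (hθs : Φ *ᵥ θs = optBellman M (Φ *ᵥ h)) (α : ℝ)
    (s : S) (a : A) (s' : S) (θ : Fin d → ℝ) :
    innerStep M Φ α h s a s' θ - θs = (θ - θs) +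
      (α * (M.γ * (maxVal (Φ *ᵥ h) s' - ∑ z, M.P a s z * maxVal (Φ *ᵥ h) z)
        - Φ (s, a) ⬝ᵥ (θ - θs))) • Φ (s, a) := by
  have h1 : Φ (s, a) ⬝ᵥ θs = M.R s a + M.γ * ∑ z, M.P a s z * maxVal (Φ *ᵥ h) z :=
    congrFun hθs (s, a)
  have h2 : M.R s a + M.γ * maxVal (Φ *ᵥ h) s' - Φ (s, a) ⬝ᵥ θ =
      M.γ * (maxVal (Φ *ᵥ h) s' - ∑ z, M.P a s z * maxVal (Φ *ᵥ h) z)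
        - Φ (s, a) ⬝ᵥ (θ - θs) := by
    rw [dotProduct_sub, h1]; ring
  rw [innerStep, h2]
  abel

omit [DecidableEq S] in
lemma abs_noise_le (h : Fin d → ℝ) (s : S) (a : A) (s' : S) :
    |M.γ * (maxVal (Φ *ᵥ h) s' - ∑ z, M.P a s z * maxVal (Φ *ᵥ h) z)| ≤ 2 * ‖Φ *ᵥ h‖ := by
  rw [abs_mul, abs_of_pos M.γ_pos]
  have h1 := abs_maxVal_le (Φ *ᵥ h) s'
  have h2 := abs_transition_sum_le M (s, a) (abs_maxVal_le (Φ *ᵥ h))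
  have h3 := abs_sub (maxVal (Φ *ᵥ h) s') (∑ z, M.P a s z * maxVal (Φ *ᵥ h) z)
  have h4 : |maxVal (Φ *ᵥ h) s' - ∑ z, M.P a s z * maxVal (Φ *ᵥ h) z| ≤ 2 * ‖Φ *ᵥ h‖ := by
    simp only at h2
    linarith
  exact (mul_le_of_le_one_left (abs_nonneg _) M.γ_lt_one.le).trans h4

omit [Fintype S] [Fintype A] [DecidableEq S] [Nonempty A] in
/-- The effect of a step of size `α` on a squared feature product. -/
lemma feature_sq_step (hΦ : ∀ y : S × A, ∑ i, |Φ y i| ≤ 1) {α w B : ℝ} (hα : 0 ≤ α)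
    (hw : |w| ≤ B) (y z : S × A) (x : Fin d → ℝ) :
    (Φ y ⬝ᵥ x) ^ 2 - α * (3 * (x ⬝ᵥ x) + B ^ 2) ≤
      (Φ y ⬝ᵥ (x + (α * (w - Φ z ⬝ᵥ x)) • Φ z)) ^ 2 := by
  have hp := feature_sq_le hΦ y x
  have hr := feature_sq_le hΦ z x
  have he : (Φ y ⬝ᵥ Φ z) ^ 2 ≤ 1 :=
    (feature_sq_le hΦ y (Φ z)).trans (dotProduct_self_le_one_of_l1 (hΦ z))
  have hw2 : w ^ 2 ≤ B ^ 2 := by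
    rw [← sq_abs]; exact pow_le_pow_left₀ (abs_nonneg _) hw 2
  rw [dotProduct_add, dotProduct_smul, smul_eq_mul]
  set p := Φ y ⬝ᵥ x
  set r := Φ z ⬝ᵥ x
  set e := Φ y ⬝ᵥ Φ z
  have hpe : (p * e) ^ 2 ≤ x ⬝ᵥ x := by
    rw [mul_pow]; nlinarith [sq_nonneg p, sq_nonneg e]
  have hkey : -(3 * (x ⬝ᵥ x) + B ^ 2) ≤ 2 * ((w - r) * (p * e)) := by
    nlinarith [sq_nonneg (w + p * e), sq_nonneg (r - p * e)]
  nlinarith [sq_nonneg (α * (w - r) * e), mul_le_mul_of_nonneg_left hkey hα]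

/-- The one-step drift of the Lyapunov function; `c` is the persistent excitation constant. -/
lemma lyapunov_drift (hΦ : ∀ y : S × A, ∑ i, |Φ y i| ≤ 1) {N : ℕ} {c : ℝ} (hc0 : 0 < c)
    (hc : ∀ s (x : Fin d → ℝ), c * (x ⬝ᵥ x) ≤
      ∑ y : S × A, (stateMatrix M π ^ N) s y.1 * π.prob y.1 y.2 * (Φ y ⬝ᵥ x) ^ 2)
    {α : ℝ} (hα0 : 0 < α) (hα1 : α ≤ 1) (hαc : 6 * N * α ≤ c)
    {h θs : Fin d → ℝ} (hθs : Φ *ᵥ θs = optBellman M (Φ *ᵥ h)) (s : S) (θ : Fin d → ℝ) :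
    innerOp M π Φ α h (fun s θ => lyapunov M π Φ α N s (θ - θs)) s θ ≤
      α ^ 2 * (N + 1) * (2 * ‖Φ *ᵥ h‖) ^ 2 +
        (1 - α * c / 2) * lyapunov M π Φ α N s (θ - θs) := by
  set B := 2 * ‖Φ *ᵥ h‖ with hB
  set x := θ - θs with hx
  set V := maxVal (Φ *ᵥ h) with hV
  set b := α * (3 * (x ⬝ᵥ x) + B ^ 2) with hb
  have hX : 0 ≤ x ⬝ᵥ x := Finset.sum_nonneg fun i _ => mul_self_nonneg _
  -- Bound the new value by a constant, a martingale difference, the drift at the current state,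
  -- and the energy of the old error seen from the new state.
  have hpt : ∀ a s', lyapunov M π Φ α N s' (innerStep M Φ α h s a s' θ - θs) ≤
      (x ⬝ᵥ x + α ^ 2 * B ^ 2 + α * (N * b)) +
        ((2 * α * (1 - α) * M.γ * (Φ (s, a) ⬝ᵥ x)) * (V s' - ∑ z, M.P a s z * V z) +
        (-α * (Φ (s, a) ⬝ᵥ x) ^ 2 + -α * energy M π Φ N s' x)) := by
    intro a s'
    have hw : |M.γ * (V s' - ∑ z, M.P a s z * V z)| ≤ B := abs_noise_le h s a s'
    rw [innerStep_sub hθs]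
    change lyapunov M π Φ α N s' (x + (α * (M.γ * (V s' - ∑ z, M.P a s z * V z)
      - Φ (s, a) ⬝ᵥ x)) • Φ (s, a)) ≤ _
    have hE := energy_sub_le (M := M) (π := π) (N := N) (s := s') fun y =>
      feature_sq_step hΦ hα0.le hw y (s, a) x
    have hw2 : (M.γ * (V s' - ∑ z, M.P a s z * V z)) ^ 2 ≤ B ^ 2 := by
      rw [← sq_abs]; exact pow_le_pow_left₀ (abs_nonneg _) hw 2
    rw [lyapunov]
    have hassoc : (2 * α * (1 - α) * M.γ * (Φ (s, a) ⬝ᵥ x)) * (V s' - ∑ z, M.P a s z * V z) =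
        2 * α * (1 - α) * (Φ (s, a) ⬝ᵥ x) * (M.γ * (V s' - ∑ z, M.P a s z * V z)) := by ring
    rw [hassoc]
    set w := M.γ * (V s' - ∑ z, M.P a s z * V z)
    have hf : Φ (s, a) ⬝ᵥ Φ (s, a) ≤ 1 := dotProduct_self_le_one_of_l1 (hΦ _)
    have hsq : (x + (α * (w - Φ (s, a) ⬝ᵥ x)) • Φ (s, a)) ⬝ᵥ
        (x + (α * (w - Φ (s, a) ⬝ᵥ x)) • Φ (s, a)) = x ⬝ᵥ x +
        2 * α * (w - Φ (s, a) ⬝ᵥ x) * (Φ (s, a) ⬝ᵥ x) +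
        (α * (w - Φ (s, a) ⬝ᵥ x)) ^ 2 * (Φ (s, a) ⬝ᵥ Φ (s, a)) := by
      simp only [dotProduct_add, add_dotProduct, dotProduct_smul, smul_dotProduct, smul_eq_mul]
      rw [dotProduct_comm x (Φ (s, a))]
      ring
    rw [hsq]
    set r := Φ (s, a) ⬝ᵥ x
    have h1 : (α * (w - r)) ^ 2 * (Φ (s, a) ⬝ᵥ Φ (s, a)) ≤ (α * (w - r)) ^ 2 :=
      mul_le_of_le_one_right (sq_nonneg _) hf
    have h2 : α ^ 2 * w ^ 2 ≤ α ^ 2 * B ^ 2 := mul_le_mul_of_nonneg_left hw2 (sq_nonneg _)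
    have h3 : α ^ 2 * r ^ 2 ≤ α * r ^ 2 :=
      mul_le_mul_of_nonneg_right (by nlinarith) (sq_nonneg _)
    have h4 := mul_le_mul_of_nonneg_left hE hα0.le
    rw [← hb] at h4
    nlinarith
  refine (stepMean_mono M π s hpt).trans ?_
  rw [stepMean_add M π s (fun _ _ => x ⬝ᵥ x + α ^ 2 * B ^ 2 + α * (N * b)), stepMean_const,
    stepMean_add, stepMean_add, stepMean_martingale M π s
      (fun a => 2 * α * (1 - α) * M.γ * (Φ (s, a) ⬝ᵥ x)) V,
    stepMean_const_mul M π s (-α) (fun a _ => (Φ (s, a) ⬝ᵥ x) ^ 2),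
    stepMean_const_mul, stepMean_action, stepMean_energy]
  have hcx := mul_le_mul_of_nonneg_left (hc s x) hα0.le
  have hE0 := energy_nonneg (M := M) (π := π) (Φ := Φ) N s x
  have hψ : lyapunov M π Φ α N s x = x ⬝ᵥ x - α * energy M π Φ N s x := rfl
  rw [hψ, hb]
  have h5 : 6 * N * α * (α * (x ⬝ᵥ x)) ≤ c * (α * (x ⬝ᵥ x)) :=
    mul_le_mul_of_nonneg_right hαc (by positivity)
  have h6 : 0 ≤ α * c * (α * energy M π Φ N s x) := by positivity
  nlinarith

/-- The mean square error after `K` inner steps started at zero. -/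
lemma innerOp_iterate_sq_le (hΦ : ∀ y : S × A, ∑ i, |Φ y i| ≤ 1) {N : ℕ} {c : ℝ} (hc0 : 0 < c)
    (hc1 : c ≤ 1) (hc : ∀ s (x : Fin d → ℝ), c * (x ⬝ᵥ x) ≤
      ∑ y : S × A, (stateMatrix M π ^ N) s y.1 * π.prob y.1 y.2 * (Φ y ⬝ᵥ x) ^ 2)
    {α : ℝ} (hα0 : 0 < α) (hα1 : α ≤ 1) (hαc : 6 * N * α ≤ c)
    {h θs : Fin d → ℝ} (hθs : Φ *ᵥ θs = optBellman M (Φ *ᵥ h)) (K : ℕ) (s : S) :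
    (innerOp M π Φ α h)^[K] (fun _ θ => (θ - θs) ⬝ᵥ (θ - θs)) s 0 ≤
      2 * (1 - α * c / 2) ^ K * (θs ⬝ᵥ θs) + α * (16 * (N + 1) / c) * ‖Φ *ᵥ h‖ ^ 2 := by
  have hsq : ∀ x : Fin d → ℝ, 0 ≤ x ⬝ᵥ x :=
    fun x => Finset.sum_nonneg fun i _ => mul_self_nonneg _
  have hlow : ∀ s (x : Fin d → ℝ), x ⬝ᵥ x ≤ 0 + 2 * lyapunov M π Φ α N s x := by
    intro s x
    have h1 := mul_le_mul_of_nonneg_left (energy_le (M := M) (π := π) hΦ N s x) hα0.le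
    have h2 := mul_le_mul_of_nonneg_right hαc (hsq x)
    have h3 := mul_le_mul_of_nonneg_right hc1 (hsq x)
    rw [lyapunov]
    nlinarith [hsq x]
  have hq0 : 0 < α * c / 2 := by positivity
  have hq1 : α * c / 2 ≤ 1 := by nlinarith
  have hup : lyapunov M π Φ α N s (0 - θs) ≤ θs ⬝ᵥ θs := by
    have := mul_nonneg hα0.le (energy_nonneg (M := M) (π := π) (Φ := Φ) N s (-θs))
    rw [zero_sub, lyapunov, neg_dotProduct_neg]
    linarith
  have hpow : 0 ≤ (1 - α * c / 2) ^ K := pow_nonneg (by linarith) K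
  refine (innerOp_iterate_mono M π Φ α h K (fun s θ => hlow s (θ - θs)) s 0).trans ?_
  rw [innerOp_iterate_affine M π Φ α h K (fun s θ => lyapunov M π Φ α N s (θ - θs))]
  have hd := innerOp_iterate_le_of_drift M π Φ α h hq0 hq1
    (lyapunov_drift hΦ hc0 hc hα0 hα1 hαc hθs) K s 0
  have hb : α ^ 2 * (N + 1) * (2 * ‖Φ *ᵥ h‖) ^ 2 / (α * c / 2) * (1 - (1 - α * c / 2) ^ K) ≤
      α * (8 * (N + 1) / c) * ‖Φ *ᵥ h‖ ^ 2 := by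
    refine (mul_le_of_le_one_right (by positivity) (by linarith)).trans (le_of_eq ?_)
    field_simp
    ring
  have h1 := mul_le_mul_of_nonneg_left hup hpow
  have h2 : α * (16 * (N + 1) / c) * ‖Φ *ᵥ h‖ ^ 2 =
      2 * (α * (8 * (N + 1) / c) * ‖Φ *ᵥ h‖ ^ 2) := by ring
  rw [h2]
  linarith

/-- One round of the outer loop, in expectation: the distance to `Q*` contracts by `γ` up to a
relative error `ρ`. -/
lemma innerOp_iterate_norm_le [DecidableEq A] [Nonempty S]
    (hΦ : ∀ y : S × A, ∑ i, |Φ y i| ≤ 1) {N : ℕ} {c : ℝ}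
    (hc0 : 0 < c) (hc1 : c ≤ 1) (hc : ∀ s (x : Fin d → ℝ), c * (x ⬝ᵥ x) ≤
      ∑ y : S × A, (stateMatrix M π ^ N) s y.1 * π.prob y.1 y.2 * (Φ y ⬝ᵥ x) ^ 2)
    {κ : ℝ} (hκ0 : 0 < κ) (hκ : ∀ x : Fin d → ℝ, x ⬝ᵥ x ≤ κ * ‖Φ *ᵥ x‖ ^ 2)
    (hsurj : Function.Surjective Φ.mulVec)
    {α : ℝ} (hα0 : 0 < α) (hα1 : α ≤ 1) (hαc : 6 * N * α ≤ c) {K : ℕ} {ρ : ℝ} (hρ : 0 < ρ)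
    (hK : 2 * κ * (1 + ‖qStar M‖) ^ 2 * (1 - α * c / 2) ^ K ≤ ρ ^ 2 / 2)
    (hαρ : 16 * (N + 1) / c * (1 + ‖qStar M‖) ^ 2 * α ≤ ρ ^ 2 / 2)
    (h : Fin d → ℝ) (s : S) :
    (innerOp M π Φ α h)^[K] (fun _ θ => ‖Φ *ᵥ θ - qStar M‖) s 0 ≤
      (M.γ + ρ) * ‖Φ *ᵥ h - qStar M‖ + ρ := by
  obtain ⟨θs, hθs⟩ := hsurj (optBellman M (Φ *ᵥ h))
  change Φ *ᵥ θs = _ at hθs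
  set E := ‖Φ *ᵥ h - qStar M‖ with hE
  have hE0 : 0 ≤ E := norm_nonneg _
  set D := 1 + ‖qStar M‖ with hD
  have hD0 : 1 ≤ D := by simp [hD]
  set r := ρ * (1 + E) with hr
  have hr0 : 0 < r := by positivity
  -- Young's inequality with weight `r` replaces Jensen's inequality for the square root.
  have hpt : ∀ (s : S) (θ : Fin d → ℝ), ‖Φ *ᵥ θ - qStar M‖ ≤
      (M.γ * E + r / 2) + 1 / (2 * r) * ((θ - θs) ⬝ᵥ (θ - θs)) := by
    intro _ θ
    have h1 : ‖Φ *ᵥ θs - qStar M‖ ≤ M.γ * E := by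
      rw [hθs]
      nth_rewrite 1 [← optBellman_qStar M]
      exact norm_optBellman_sub_le M _ _
    have h2 : ‖Φ *ᵥ (θ - θs)‖ ≤ √((θ - θs) ⬝ᵥ (θ - θs)) := by
      refine (pi_norm_le_iff_of_nonneg (Real.sqrt_nonneg _)).2 fun y => ?_
      exact Real.abs_le_sqrt (feature_sq_le hΦ y _)
    have h3 : √((θ - θs) ⬝ᵥ (θ - θs)) ≤ r / 2 + 1 / (2 * r) * ((θ - θs) ⬝ᵥ (θ - θs)) := by
      have hX : 0 ≤ (θ - θs) ⬝ᵥ (θ - θs) := Finset.sum_nonneg fun i _ => mul_self_nonneg _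
      set t := √((θ - θs) ⬝ᵥ (θ - θs)) with ht
      have hXt : (θ - θs) ⬝ᵥ (θ - θs) = t ^ 2 := (Real.sq_sqrt hX).symm
      rw [hXt]
      have : r / 2 + 1 / (2 * r) * t ^ 2 - t = (r - t) ^ 2 / (2 * r) := by
        field_simp
        ring
      have h0 : 0 ≤ (r - t) ^ 2 / (2 * r) := by positivity
      linarith
    have h4 : Φ *ᵥ θ - qStar M = (Φ *ᵥ θs - qStar M) + Φ *ᵥ (θ - θs) := by
      rw [Matrix.mulVec_sub]; abel
    rw [h4]
    linarith [norm_add_le (Φ *ᵥ θs - qStar M) (Φ *ᵥ (θ - θs))]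
  refine (innerOp_iterate_mono M π Φ α h K hpt s 0).trans ?_
  rw [innerOp_iterate_affine M π Φ α h K (fun _ θ => (θ - θs) ⬝ᵥ (θ - θs))]
  have hsq := innerOp_iterate_sq_le hΦ hc0 hc1 hc hα0 hα1 hαc hθs K s
  have hh : 1 + ‖Φ *ᵥ h‖ ≤ D * (1 + E) := by
    have : ‖Φ *ᵥ h‖ ≤ E + ‖qStar M‖ := by
      simpa using norm_add_le (Φ *ᵥ h - qStar M) (qStar M)
    have h0 : 0 ≤ ‖qStar M‖ := norm_nonneg _
    rw [hD]
    nlinarith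
  have hθ : θs ⬝ᵥ θs ≤ κ * (D * (1 + E)) ^ 2 := by
    refine (hκ θs).trans (mul_le_mul_of_nonneg_left ?_ hκ0.le)
    rw [hθs]
    exact pow_le_pow_left₀ (norm_nonneg _) ((norm_optBellman_le M _).trans hh) 2
  have hh2 : ‖Φ *ᵥ h‖ ^ 2 ≤ (D * (1 + E)) ^ 2 :=
    pow_le_pow_left₀ (norm_nonneg _) (by linarith) 2
  have hq1 : α * c / 2 ≤ 1 := by nlinarith
  have hpow : 0 ≤ (1 - α * c / 2) ^ K := pow_nonneg (by linarith) K
  have hfinal : (innerOp M π Φ α h)^[K] (fun _ θ => (θ - θs) ⬝ᵥ (θ - θs)) s 0 ≤ r ^ 2 := by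
    refine hsq.trans ?_
    have h1 : 2 * (1 - α * c / 2) ^ K * (θs ⬝ᵥ θs) ≤ ρ ^ 2 / 2 * (1 + E) ^ 2 := by
      calc 2 * (1 - α * c / 2) ^ K * (θs ⬝ᵥ θs)
          ≤ 2 * (1 - α * c / 2) ^ K * (κ * (D * (1 + E)) ^ 2) :=
            mul_le_mul_of_nonneg_left hθ (by positivity)
        _ = 2 * κ * D ^ 2 * (1 - α * c / 2) ^ K * (1 + E) ^ 2 := by ring
        _ ≤ _ := mul_le_mul_of_nonneg_right hK (sq_nonneg _)
    have h2 : α * (16 * (N + 1) / c) * ‖Φ *ᵥ h‖ ^ 2 ≤ ρ ^ 2 / 2 * (1 + E) ^ 2 := by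
      calc α * (16 * (N + 1) / c) * ‖Φ *ᵥ h‖ ^ 2
          ≤ α * (16 * (N + 1) / c) * (D * (1 + E)) ^ 2 :=
            mul_le_mul_of_nonneg_left hh2 (by positivity)
        _ = 16 * (N + 1) / c * D ^ 2 * α * (1 + E) ^ 2 := by ring
        _ ≤ _ := mul_le_mul_of_nonneg_right hαρ (sq_nonneg _)
    rw [hr]
    nlinarith
  have h1 : 1 / (2 * r) * (innerOp M π Φ α h)^[K] (fun _ θ => (θ - θs) ⬝ᵥ (θ - θs)) s 0 ≤
      r / 2 := by
    refine (mul_le_mul_of_nonneg_left hfinal (by positivity)).trans (le_of_eq ?_)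
    field_simp
  have h2 : (M.γ + ρ) * E + ρ = M.γ * E + r / 2 + r / 2 := by rw [hr]; ring
  rw [h2]
  linarith

end Lyapunov

/-! ### The Markov property of trajectories -/

section Trajectory

open MeasureTheory

variable {S A Ω : Type*} [Fintype S] [Fintype A]

/-- The history `(S₀, …, Sₙ, A₀, …, Aₙ₋₁)` of a trajectory. -/
def history (X : ℕ → Ω → S) (U : ℕ → Ω → A) (n : ℕ) (ω : Ω) :
    (Fin (n + 1) → S) × (Fin n → A) :=
  (fun i => X i ω, fun i => U i ω)

omit [Fintype S] [Fintype A] in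
lemma history_eq_iff {X : ℕ → Ω → S} {U : ℕ → Ω → A} {n : ℕ} {ω : Ω}
    {y : (Fin (n + 1) → S) × (Fin n → A)} :
    history X U n ω = y ↔ (∀ i : Fin (n + 1), X i ω = y.1 i) ∧ ∀ i : Fin n, U i ω = y.2 i := by
  simp [history, Prod.ext_iff, funext_iff]

omit [Fintype S] [Fintype A] in
/-- A quantity determined by the path up to time `n` is a function of the history. -/
lemma exists_eq_comp_history {W : Type*} [Nonempty W] {X : ℕ → Ω → S} {U : ℕ → Ω → A}
    {n : ℕ} {V : Ω → W} (hV : ∀ ω ω', (∀ i ≤ n, X i ω = X i ω') → (∀ i < n, U i ω = U i ω') →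
      V ω = V ω') : ∃ g : (Fin (n + 1) → S) × (Fin n → A) → W, ∀ ω, V ω = g (history X U n ω) := by
  have hf : V.FactorsThrough (history X U n) := by
    intro ω ω' hω
    rw [history_eq_iff] at hω
    exact hV ω ω' (fun i hi => hω.1 ⟨i, by omega⟩) fun i hi => hω.2 ⟨i, hi⟩
  obtain ⟨g, hg⟩ := (Function.factorsThrough_iff V).1 hf
  exact ⟨g, congrFun hg⟩

variable [MeasurableSpace Ω] {M : MDP S A} {π : Policy S A} {ℙ : Measure Ω}
  {X : ℕ → Ω → S} {U : ℕ → Ω → A}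

lemma IsTrajectory.measurableSet_history (hT : IsTrajectory M π ℙ X U) (n : ℕ)
    (y : (Fin (n + 1) → S) × (Fin n → A)) : MeasurableSet {ω | history X U n ω = y} := by
  simp only [history_eq_iff]
  exact (MeasurableSet.iInter fun i : Fin (n + 1) => hT.measurable_state i (y.1 i)).inter
    (MeasurableSet.iInter fun i : Fin n => hT.measurable_action i (y.2 i)) |>.congr (by
      ext ω; simp)

/-- The Markov property on atoms of the history. -/
lemma IsTrajectory.real_history_inter (hT : IsTrajectory M π ℙ X U) (n : ℕ)
    (y : (Fin (n + 1) → S) × (Fin n → A)) (a : A) (s' : S) :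
    ℙ.real {ω | history X U n ω = y ∧ U n ω = a ∧ X (n + 1) ω = s'} =
      ℙ.real {ω | history X U n ω = y} *
        (π.prob (y.1 (Fin.last n)) a * M.P a (y.1 (Fin.last n)) s') := by
  -- Extend the history by `a` and `s'` to infinite paths, as `path_prob` expects.
  let σ : ℕ → S := fun i => if h : i < n + 1 then y.1 ⟨i, h⟩ else s'
  let τ : ℕ → A := fun i => if h : i < n then y.2 ⟨i, h⟩ else a
  have hσ : ∀ i : Fin (n + 1), σ i = y.1 i := fun i => by
    simp only [σ, i.isLt, dif_pos]
  have hτ : ∀ i : Fin n, τ i = y.2 i := fun i => by simp [τ]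
  have h1 : {ω | history X U n ω = y} =
      {ω | (∀ i ≤ n, X i ω = σ i) ∧ ∀ i < n, U i ω = τ i} := by
    ext ω
    simp only [history_eq_iff, Set.mem_ofPred_eq, ← hσ, ← hτ]
    rw [Fin.forall_iff, Fin.forall_iff]
    simp only [Nat.lt_succ_iff]
  have h2 : {ω | history X U n ω = y ∧ U n ω = a ∧ X (n + 1) ω = s'} =
      {ω | (∀ i ≤ n + 1, X i ω = σ i) ∧ ∀ i < n + 1, U i ω = τ i} := by
    ext ω
    have h3 : history X U n ω = y ↔
        (∀ i ≤ n, X i ω = σ i) ∧ ∀ i < n, U i ω = τ i := Set.ext_iff.1 h1 ω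
    have hs' : σ (n + 1) = s' := by simp [σ]
    have ha' : τ n = a := by simp [τ]
    simp only [Set.mem_ofPred_eq, h3, Nat.le_succ_iff, Nat.lt_succ_iff_lt_or_eq, or_imp,
      forall_and, forall_eq, hs', ha', Nat.succ_eq_add_one]
    tauto
  have hsn : σ n = y.1 (Fin.last n) := hσ (Fin.last n)
  rw [h1, h2, hT.path_prob, hT.path_prob, Finset.prod_range_succ, hsn]
  simp [σ, τ, mul_assoc]

variable [IsProbabilityMeasure ℙ]

/-- Functions of the history take finitely many values, so they are integrable. -/
lemma IsTrajectory.integrable_history (hT : IsTrajectory M π ℙ X U) (n : ℕ)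
    (G : (Fin (n + 1) → S) × (Fin n → A) → ℝ) :
    Integrable (fun ω => G (history X U n ω)) ℙ := by
  let : MeasurableSpace ((Fin (n + 1) → S) × (Fin n → A)) := ⊤
  have hm : Measurable (history X U n) :=
    measurable_to_countable' fun y => hT.measurableSet_history n y
  have := Measure.isProbabilityMeasure_map hm.aemeasurable (μ := ℙ)
  exact (Integrable.of_finite (μ := ℙ.map (history X U n)) (f := G)).comp_measurable hm

/-- One-step Markov property: averaging over the next action and state does not change the
expectation. -/
lemma IsTrajectory.integral_step (hT : IsTrajectory M π ℙ X U) (n : ℕ)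
    (G : (Fin (n + 1) → S) × (Fin n → A) → A → S → ℝ) :
    ∫ ω, G (history X U n ω) (U n ω) (X (n + 1) ω) ∂ℙ =
      ∫ ω, stepMean M π (X n ω) (G (history X U n ω)) ∂ℙ := by
  let : MeasurableSpace ((Fin (n + 1) → S) × (Fin n → A)) := ⊤
  let : MeasurableSpace (((Fin (n + 1) → S) × (Fin n → A)) × A × S) := ⊤
  have hm : Measurable (history X U n) :=
    measurable_to_countable' fun y => hT.measurableSet_history n y
  let Z : Ω → ((Fin (n + 1) → S) × (Fin n → A)) × A × S :=
    fun ω => (history X U n ω, U n ω, X (n + 1) ω)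
  have hZset : ∀ z, Z ⁻¹' {z} =
      {ω | history X U n ω = z.1 ∧ U n ω = z.2.1 ∧ X (n + 1) ω = z.2.2} := by
    intro z; ext ω; simp [Z, Prod.ext_iff]
  have hZm : Measurable Z := measurable_to_countable' fun z => by
    rw [hZset]
    exact (hT.measurableSet_history n z.1).inter
      ((hT.measurable_action n z.2.1).inter (hT.measurable_state (n + 1) z.2.2))
  have := Measure.isProbabilityMeasure_map hm.aemeasurable (μ := ℙ)
  have := Measure.isProbabilityMeasure_map hZm.aemeasurable (μ := ℙ)
  have hl : ∫ ω, G (history X U n ω) (U n ω) (X (n + 1) ω) ∂ℙ =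
      ∫ z, G z.1 z.2.1 z.2.2 ∂(ℙ.map Z) :=
    (integral_map (φ := Z) hZm.aemeasurable
      (f := fun z => G z.1 z.2.1 z.2.2) AEStronglyMeasurable.of_discrete).symm
  have hr : ∫ ω, stepMean M π (X n ω) (G (history X U n ω)) ∂ℙ =
      ∫ y, stepMean M π (y.1 (Fin.last n)) (G y) ∂(ℙ.map (history X U n)) :=
    (integral_map (φ := history X U n) hm.aemeasurable
      (f := fun y => stepMean M π (y.1 (Fin.last n)) (G y))
      AEStronglyMeasurable.of_discrete).symm
  rw [hl, hr, integral_fintype Integrable.of_finite, integral_fintype Integrable.of_finite,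
    Fintype.sum_prod_type]
  refine Finset.sum_congr rfl fun y _ => ?_
  rw [Fintype.sum_prod_type, stepMean, smul_eq_mul, Finset.mul_sum]
  refine Finset.sum_congr rfl fun a _ => ?_
  rw [Finset.mul_sum, Finset.mul_sum]
  refine Finset.sum_congr rfl fun s' _ => ?_
  rw [map_measureReal_apply hZm (measurableSet_singleton _),
    map_measureReal_apply hm (measurableSet_singleton _), hZset, smul_eq_mul]
  change ℙ.real {ω | history X U n ω = y ∧ U n ω = a ∧ X (n + 1) ω = s'} * _ =
    ℙ.real {ω | history X U n ω = y} * _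
  rw [hT.real_history_inter]
  ring

end Trajectory

/-! ### The iterates along a trajectory -/

section Iterates

open MeasureTheory

variable {S A Ω : Type*} [Fintype S] [Fintype A] [Nonempty A] {d : ℕ}
  (M : MDP S A) (Φ : Matrix (S × A) (Fin d) ℝ) (α : ℝ)

lemma innerIter_succ (x : ℕ → S) (u : ℕ → A) (h : Fin d → ℝ) (k : ℕ) :
    innerIter M Φ (fun _ => α) x u h (k + 1) =
      innerStep M Φ α h (x k) (u k) (x (k + 1)) (innerIter M Φ (fun _ => α) x u h k) :=
  rfl

variable {M Φ α}

lemma innerIter_congr {x x' : ℕ → S} {u u' : ℕ → A} {h : Fin d → ℝ} {k : ℕ}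
    (hx : ∀ i ≤ k, x i = x' i) (hu : ∀ i < k, u i = u' i) :
    innerIter M Φ (fun _ => α) x u h k = innerIter M Φ (fun _ => α) x' u' h k := by
  induction k with
  | zero => rfl
  | succ k ih =>
    rw [innerIter_succ, innerIter_succ,
      ih (fun i hi => hx i (by omega)) fun i hi => hu i (by omega),
      hx k (by omega), hx (k + 1) le_rfl, hu k (by omega)]

lemma targetIter_congr {K : ℕ} {x x' : ℕ → S} {u u' : ℕ → A} {t : ℕ}
    (hx : ∀ i ≤ t * K, x i = x' i) (hu : ∀ i < t * K, u i = u' i) :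
    targetIter M Φ (fun _ => α) K x u t = targetIter M Φ (fun _ => α) K x' u' t := by
  induction t with
  | zero => rfl
  | succ t ih =>
    have hk : (t + 1) * K = t * K + K := by ring
    rw [hk] at hx hu
    rw [targetIter, targetIter, ih (fun i hi => hx i (by omega)) fun i hi => hu i (by omega)]
    exact innerIter_congr (fun i hi => hx _ (by omega)) fun i hi => hu _ (by omega)

variable [MeasurableSpace Ω] {π : Policy S A} {ℙ : Measure Ω} [IsProbabilityMeasure ℙ]
  {X : ℕ → Ω → S} {U : ℕ → Ω → A}

omit [Nonempty A] in
lemma IsTrajectory.integrable_of_determined (hT : IsTrajectory M π ℙ X U) {n : ℕ} {V : Ω → ℝ}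
    (hV : ∀ ω ω', (∀ i ≤ n, X i ω = X i ω') → (∀ i < n, U i ω = U i ω') → V ω = V ω') :
    Integrable V ℙ := by
  obtain ⟨g, hg⟩ := exists_eq_comp_history hV
  rw [show V = fun ω => g (history X U n ω) from funext hg]
  exact hT.integrable_history n g

lemma IsTrajectory.integrable_targetIter (hT : IsTrajectory M π ℙ X U) (K t : ℕ)
    (f : (Fin d → ℝ) → S → ℝ) :
    Integrable (fun ω => f (targetIter M Φ (fun _ => α) K (fun k => X k ω) (fun k => U k ω) t)
      (X (t * K) ω)) ℙ :=
  hT.integrable_of_determined (n := t * K) fun ω ω' hx hu => by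
    rw [targetIter_congr hx hu, hx _ le_rfl]

/-- The expectation of a function of the parameter after a round is obtained by applying the
transition operator of the inner loop `K` times at the start of the round. -/
lemma IsTrajectory.integral_targetIter_succ [Nonempty S] (hT : IsTrajectory M π ℙ X U) (K t : ℕ)
    (f : S → (Fin d → ℝ) → ℝ) :
    ∫ ω, f (X ((t + 1) * K) ω)
        (targetIter M Φ (fun _ => α) K (fun k => X k ω) (fun k => U k ω) (t + 1)) ∂ℙ =
      ∫ ω, (innerOp M π Φ α
        (targetIter M Φ (fun _ => α) K (fun k => X k ω) (fun k => U k ω) t))^[K] f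
          (X (t * K) ω) 0 ∂ℙ := by
  set H : Ω → Fin d → ℝ := fun ω =>
    targetIter M Φ (fun _ => α) K (fun k => X k ω) (fun k => U k ω) t with hH
  set Θ : ℕ → Ω → Fin d → ℝ := fun k ω => innerIter M Φ (fun _ => α)
    (fun i => X (t * K + i) ω) (fun i => U (t * K + i) ω) (H ω) k with hΘ
  have key : ∀ j k, j + k = K →
      ∫ ω, (innerOp M π Φ α (H ω))^[j] f (X (t * K + k) ω) (Θ k ω) ∂ℙ =
        ∫ ω, (innerOp M π Φ α (H ω))^[K] f (X (t * K) ω) 0 ∂ℙ := by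
    intro j k
    induction k generalizing j with
    | zero =>
      rintro rfl
      rfl
    | succ k ih =>
      intro hjk
      rw [← ih (j + 1) (by omega)]
      obtain ⟨g, hg⟩ := exists_eq_comp_history (X := X) (U := U) (n := t * K + k)
        (V := fun ω => (H ω, Θ k ω, X (t * K + k) ω)) (by
          intro ω ω' hx hu
          have h1 : H ω = H ω' :=
            targetIter_congr (fun i hi => hx i (by omega)) fun i hi => hu i (by omega)
          have h2 : Θ k ω = Θ k ω' := by
            simp only [hΘ, h1]
            exact innerIter_congr (fun i hi => hx _ (by omega)) fun i hi => hu _ (by omega)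
          simp only [h1, h2, hx _ le_rfl])
      have hstep := hT.integral_step (t * K + k) fun y a s' =>
        (innerOp M π Φ α (g y).1)^[j] f s'
          (innerStep M Φ α (g y).1 (g y).2.2 a s' (g y).2.1)
      simp only [← hg] at hstep
      simp only [Function.iterate_succ_apply']
      exact hstep
  have h0 := key 0 K (by omega)
  rw [← h0, show (t + 1) * K = t * K + K by ring]
  rfl

end Iterates

/-! ### Convergence rate and choice of parameters -/

section Convergence

open MeasureTheory

lemma exists_dotProduct_self_le {ι : Type*} [Fintype ι] {d : ℕ} {Φ : Matrix ι (Fin d) ℝ}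
    (hΦ : Function.Injective Φ.mulVec) :
    ∃ κ : ℝ, 1 ≤ κ ∧ ∀ x : Fin d → ℝ, x ⬝ᵥ x ≤ κ * ‖Φ *ᵥ x‖ ^ 2 := by
  obtain ⟨C, -, hC⟩ := Φ.mulVecLin.exists_antilipschitzWith (LinearMap.ker_eq_bot.2 hΦ)
  refine ⟨1 + d * (C : ℝ) ^ 2, by simp; positivity, fun x => ?_⟩
  have h1 : ‖x‖ ≤ C * ‖Φ *ᵥ x‖ := by
    have := hC.le_mul_dist x 0
    rw [map_zero, dist_zero_right, dist_zero_right] at this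
    exact this
  calc x ⬝ᵥ x ≤ ∑ _i : Fin d, ‖x‖ ^ 2 := by
        refine Finset.sum_le_sum fun i _ => ?_
        rw [← pow_two, ← sq_abs]
        exact pow_le_pow_left₀ (abs_nonneg _) (norm_le_pi_norm x i) 2
    _ = d * ‖x‖ ^ 2 := by simp
    _ ≤ d * (C * ‖Φ *ᵥ x‖) ^ 2 := by gcongr
    _ ≤ _ := by nlinarith [sq_nonneg ‖Φ *ᵥ x‖]

/-- Persistent excitation: after enough steps every state-action pair, hence every direction of
the parameter space, is visited with positive probability, whatever the initial state. -/
lemma exists_excitation {S A : Type*} [Fintype S] [Fintype A] [DecidableEq S]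
    [Nonempty S] [Nonempty A] {M : MDP S A} {π : Policy S A} (hπ : ∀ s a, 0 < π.prob s a)
    {d : ℕ} {Φ : Matrix (S × A) (Fin d) ℝ} {κ : ℝ} (hκ1 : 1 ≤ κ)
    (hκ : ∀ x : Fin d → ℝ, x ⬝ᵥ x ≤ κ * ‖Φ *ᵥ x‖ ^ 2) {N : ℕ} {c : ℝ} (hc0 : 0 < c)
    (hc1 : c ≤ 1) (hc : ∀ i j, c ≤ (stateMatrix M π ^ N) i j) :
    ∃ b : ℝ, 0 < b ∧ b ≤ 1 ∧ ∀ s (x : Fin d → ℝ), b * (x ⬝ᵥ x) ≤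
      ∑ y : S × A, (stateMatrix M π ^ N) s y.1 * π.prob y.1 y.2 * (Φ y ⬝ᵥ x) ^ 2 := by
  obtain ⟨z, hz⟩ := Finite.exists_min fun z : S × A => π.prob z.1 z.2
  set p := π.prob z.1 z.2 with hp
  have hp0 : 0 < p := hπ _ _
  have hp1 : p ≤ 1 := by
    rw [← π.sum_eq_one z.1]
    exact Finset.single_le_sum (fun a _ => π.nonneg z.1 a) (Finset.mem_univ z.2)
  have hκ0 : 0 < κ := by linarith
  refine ⟨c * p / κ, by positivity, ?_, fun s x => ?_⟩
  · rw [div_le_one hκ0]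
    exact (mul_le_one₀ hc1 hp0.le hp1).trans hκ1
  · obtain ⟨y, hy⟩ : ∃ y, ‖(Φ *ᵥ x) y‖ = ‖Φ *ᵥ x‖ := by
      obtain ⟨y, hy⟩ := Finite.exists_max fun y => ‖(Φ *ᵥ x) y‖
      exact ⟨y, le_antisymm (norm_le_pi_norm _ y)
        ((pi_norm_le_iff_of_nonneg (norm_nonneg _)).2 hy)⟩
    have h1 : ‖Φ *ᵥ x‖ ^ 2 = (Φ y ⬝ᵥ x) ^ 2 := by
      rw [← hy, Real.norm_eq_abs, sq_abs]; rfl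
    calc c * p / κ * (x ⬝ᵥ x) ≤ c * p / κ * (κ * ‖Φ *ᵥ x‖ ^ 2) :=
          mul_le_mul_of_nonneg_left (hκ x) (by positivity)
      _ = c * p * (Φ y ⬝ᵥ x) ^ 2 := by rw [h1]; field_simp
      _ ≤ (stateMatrix M π ^ N) s y.1 * π.prob y.1 y.2 * (Φ y ⬝ᵥ x) ^ 2 := by
          refine mul_le_mul_of_nonneg_right ?_ (sq_nonneg _)
          exact mul_le_mul (hc s y.1) (hz y) hp0.le (hc0.le.trans (hc _ _))
      _ ≤ _ := Finset.single_le_sum (f := fun y : S × A =>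
          (stateMatrix M π ^ N) s y.1 * π.prob y.1 y.2 * (Φ y ⬝ᵥ x) ^ 2)
          (fun y _ => mul_nonneg (law_nonneg N s y) (sq_nonneg _)) (Finset.mem_univ y)

/-- The number of contractions that reach the accuracy `b εʲ` is logarithmic in `1/ε`. -/
lemma one_sub_pow_le_mul_pow {q b ε : ℝ} (hq : q ≤ 1) (hb0 : 0 < b) (hb1 : b ≤ 1)
    (hε0 : 0 < ε) (hε1 : ε < 1) {j K : ℕ}
    (hK : (Real.log (1 / b) + j) * (1 + Real.log (1 / ε)) ≤ q * K) :
    (1 - q) ^ K ≤ b * ε ^ j := by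
  have hlb : 0 ≤ Real.log (1 / b) := Real.log_nonneg (by rw [le_div_iff₀ hb0]; linarith)
  have hle : 0 ≤ Real.log (1 / ε) := Real.log_nonneg (by rw [le_div_iff₀ hε0]; linarith)
  have h1 : (1 - q) ^ K ≤ Real.exp (-(q * K)) := by
    have h2 : (1 - q) ^ K ≤ Real.exp (-q) ^ K :=
      pow_le_pow_left₀ (by linarith) (by linarith [Real.add_one_le_exp (-q)]) K
    rwa [← Real.exp_nat_mul, show (K : ℝ) * -q = -(q * K) by ring] at h2
  have h3 : Real.log (1 / b) + j * Real.log (1 / ε) ≤ q * K := by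
    have : (0 : ℝ) ≤ j := j.cast_nonneg
    nlinarith [mul_nonneg hlb hle]
  calc (1 - q) ^ K ≤ Real.exp (-(q * K)) := h1
    _ ≤ Real.exp (Real.log b + j * Real.log ε) := by
        refine Real.exp_le_exp.2 ?_
        rw [one_div, one_div, Real.log_inv, Real.log_inv] at h3
        linarith
    _ = b * ε ^ j := by
        rw [Real.exp_add, Real.exp_log hb0, Real.exp_nat_mul, Real.exp_log hε0]

lemma exists_stepsize {u c v G : ℝ} (hu : 0 < u) (hc : 0 < c) (hv : 0 < v) (hG : 0 < G)
    (N : ℕ) : ∃ a : ℝ, 0 < a ∧ a ≤ 1 ∧ a ≤ u ∧ 6 * N * a ≤ c ∧ G * a ≤ v := by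
  obtain ⟨a, ha0, ha⟩ := exists_between
    (show 0 < min (min 1 u) (min (c / (6 * N + 1)) (v / G)) by positivity)
  simp only [lt_min_iff] at ha
  obtain ⟨⟨h1, h2⟩, h3, h4⟩ := ha
  rw [lt_div_iff₀ (by positivity)] at h3 h4
  exact ⟨a, ha0, h1.le, h2.le, by linarith, by linarith⟩

/-- The number of outer rounds after which the initial error is negligible. -/
lemma geometric_add_lt {γ ε Q : ℝ} (hγ0 : 0 < γ) (hγ1 : γ < 1) (hQ : 0 ≤ Q) (hε0 : 0 < ε)
    (hε1 : ε < 1) {t : ℕ}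
    (ht : 2 / (1 - γ) * (Real.log (4 * (1 + Q)) + 1) * (1 + Real.log (1 / ε)) ≤ t) :
    (1 - (1 - γ) / 2) ^ t * Q + 2 * ((1 - γ) * ε / 8) / (1 - γ) < ε := by
  have hγ : 0 < 1 - γ := sub_pos.2 hγ1
  have hpow : (1 - (1 - γ) / 2) ^ t ≤ 1 / (4 * (1 + Q)) * ε ^ 1 := by
    refine one_sub_pow_le_mul_pow (by linarith) (by positivity) ?_ hε0 hε1 ?_
    · rw [div_le_one (by positivity)]; linarith
    · refine le_trans (le_of_eq ?_)
        (mul_le_mul_of_nonneg_left ht (show 0 ≤ (1 - γ) / 2 by positivity))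
      rw [one_div_one_div]
      push_cast
      field_simp
  have h2 : (1 - (1 - γ) / 2) ^ t * Q ≤ ε / 4 := by
    calc (1 - (1 - γ) / 2) ^ t * Q ≤ 1 / (4 * (1 + Q)) * ε ^ 1 * (1 + Q) :=
          mul_le_mul hpow (by linarith) hQ (by positivity)
      _ = ε / 4 := by field_simp
  have h3 : 2 * ((1 - γ) * ε / 8) / (1 - γ) = ε / 4 := by
    field_simp
    norm_num
  linarith

variable {S A : Type*} [Fintype S] [Fintype A] [DecidableEq S] [DecidableEq A]
  [Nonempty S] [Nonempty A] {M : MDP S A} {π : Policy S A} {d : ℕ}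
  {Φ : Matrix (S × A) (Fin d) ℝ} {Ω : Type*} [MeasurableSpace Ω] {ℙ : Measure Ω}
  [IsProbabilityMeasure ℙ] {X : ℕ → Ω → S} {U : ℕ → Ω → A}

/-- If one inner loop contracts the distance to `Q*` in expectation from every state and target
parameter, the outer loop converges geometrically up to the accuracy of the inner loop. -/
lemma IsTrajectory.integral_norm_targetIter_le (hT : IsTrajectory M π ℙ X U) {α : ℝ} {K : ℕ}
    {ρ : ℝ} (hρ : 0 ≤ ρ) (hργ : ρ ≤ (1 - M.γ) / 2)
    (hloop : ∀ (h : Fin d → ℝ) (s : S),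
      (innerOp M π Φ α h)^[K] (fun _ θ => ‖Φ *ᵥ θ - qStar M‖) s 0 ≤
        (M.γ + ρ) * ‖Φ *ᵥ h - qStar M‖ + ρ) (t : ℕ) :
    ∫ ω, ‖Φ *ᵥ targetIter M Φ (fun _ => α) K (fun k => X k ω) (fun k => U k ω) t
        - qStar M‖ ∂ℙ ≤
      (1 - (1 - M.γ) / 2) ^ t * ‖qStar M‖ + 2 * ρ / (1 - M.γ) := by
  have hγ : 0 < 1 - M.γ := sub_pos.2 M.γ_lt_one
  induction t with
  | zero =>
    simp only [targetIter, Matrix.mulVec_zero, zero_sub, norm_neg, integral_const, probReal_univ,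
      one_smul, pow_zero, one_mul]
    have : 0 ≤ 2 * ρ / (1 - M.γ) := by positivity
    linarith
  | succ t ih =>
    set e := ∫ ω, ‖Φ *ᵥ targetIter M Φ (fun _ => α) K (fun k => X k ω) (fun k => U k ω) t
      - qStar M‖ ∂ℙ with he
    have hint := hT.integrable_targetIter (Φ := Φ) (α := α) K t
      fun h _ => ‖Φ *ᵥ h - qStar M‖
    have he0 : 0 ≤ e := integral_nonneg fun ω => norm_nonneg _
    have h1 : ∫ ω, ‖Φ *ᵥ targetIter M Φ (fun _ => α) K (fun k => X k ω) (fun k => U k ω) (t + 1)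
        - qStar M‖ ∂ℙ ≤ (M.γ + ρ) * e + ρ := by
      rw [hT.integral_targetIter_succ K t fun _ θ => ‖Φ *ᵥ θ - qStar M‖]
      refine (integral_mono (hT.integrable_targetIter K t fun h s =>
        (innerOp M π Φ α h)^[K] (fun _ θ => ‖Φ *ᵥ θ - qStar M‖) s 0)
        ((hint.const_mul (M.γ + ρ)).add (integrable_const ρ)) fun ω => hloop _ _).trans
        (le_of_eq ?_)
      simp only [Pi.add_apply]
      rw [integral_add (hint.const_mul _) (integrable_const ρ), integral_const_mul]
      simp [he]
    refine h1.trans ?_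
    have hβ : M.γ + ρ ≤ 1 - (1 - M.γ) / 2 := by linarith
    have hβ0 : 0 ≤ 1 - (1 - M.γ) / 2 := by linarith [M.γ_pos]
    calc (M.γ + ρ) * e + ρ ≤ (1 - (1 - M.γ) / 2) * e + ρ := by
          linarith [mul_le_mul_of_nonneg_right hβ he0]
      _ ≤ (1 - (1 - M.γ) / 2) *
            ((1 - (1 - M.γ) / 2) ^ t * ‖qStar M‖ + 2 * ρ / (1 - M.γ)) + ρ := by
          linarith [mul_le_mul_of_nonneg_left ih hβ0]
      _ = _ := by
          field_simp
          ring

/-- The sample complexity bound, for features that span all functions of state and action. -/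
lemma exists_sample_complexity_bound (hπ : IsExploring M π)
    (hΦ1 : ∀ y : S × A, ∑ i, |Φ y i| ≤ 1) (hinj : Function.Injective Φ.mulVec)
    (hsurj : Function.Surjective Φ.mulVec) (hlam : 0 < lambdaMin M π Φ) :
    ∃ C : ℝ, 0 < C ∧ ∀ ε : ℝ, 0 < ε → ε < 1 → ∃ (α : ℝ) (K T : ℕ),
      0 < α ∧ α ≤ lambdaMin M π Φ * (1 - M.γ) ^ 2 / 130 ∧ mixingTime M π α + 1 ≤ K ∧
      ((K * T : ℕ) : ℝ) ≤ C * (1 / ε ^ 2) * (1 + Real.log (1 / ε)) ^ 2 ∧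
      ∃ ρ : ℝ, 0 ≤ ρ ∧ ρ ≤ (1 - M.γ) / 2 ∧
        (∀ (h : Fin d → ℝ) (s : S),
          (innerOp M π Φ α h)^[K] (fun _ θ => ‖Φ *ᵥ θ - qStar M‖) s 0 ≤
            (M.γ + ρ) * ‖Φ *ᵥ h - qStar M‖ + ρ) ∧
        ∀ t : ℕ, T ≤ t → (1 - (1 - M.γ) / 2) ^ t * ‖qStar M‖ + 2 * ρ / (1 - M.γ) < ε := by
  obtain ⟨N, c₁, hc₁0, hc₁1, hc₁⟩ := hπ.exists_pow_ge
  obtain ⟨κ, hκ1, hκ⟩ := exists_dotProduct_self_le hinj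
  obtain ⟨c, hc0, hc1, hc⟩ := exists_excitation hπ.1 hκ1 hκ hc₁0 hc₁1 hc₁
  have hγ : 0 < 1 - M.γ := sub_pos.2 M.γ_lt_one
  have hγ1 : 1 - M.γ ≤ 1 := by linarith [M.γ_pos]
  set D := 1 + ‖qStar M‖ with hD
  have hD1 : 1 ≤ D := by simp [hD]
  have hκ0 : 0 < κ := by linarith
  -- The inner loop is run to the relative accuracy `ρ = (1 - γ) ε / 8`; its noise floor is
  -- proportional to `√α`, whence the stepsize `α = a ε²`.
  set G := 16 * (N + 1) / c * D ^ 2 with hG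
  have hG0 : 0 < G := by positivity
  obtain ⟨a, ha0, ha1, halam, haN, haG⟩ := exists_stepsize
    (show 0 < lambdaMin M π Φ * (1 - M.γ) ^ 2 / 130 by positivity) hc0
    (show 0 < (1 - M.γ) ^ 2 / 128 by positivity) hG0 N
  -- `b ε²` is the factor to which the inner loop has to shrink the initial mean square error.
  set b := (1 - M.γ) ^ 2 / (256 * κ * D ^ 2) with hb
  have hb0 : 0 < b := by positivity
  have hb1 : b ≤ 1 := by
    rw [hb, div_le_one (by positivity)]
    have h1 : (1 - M.γ) ^ 2 ≤ 1 := pow_le_one₀ hγ.le hγ1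
    have h2 : 1 ≤ D ^ 2 := one_le_pow₀ hD1
    nlinarith
  set k₀ := 2 * (Real.log (1 / b) + 2) / (a * c) with hk₀
  set t₀ := 2 / (1 - M.γ) * (Real.log (4 * D) + 1) with ht₀
  have hlb : 0 ≤ Real.log (1 / b) := Real.log_nonneg (by rw [le_div_iff₀ hb0]; linarith)
  have hlD : 0 ≤ Real.log (4 * D) := Real.log_nonneg (by linarith)
  have hk₀0 : 0 < k₀ := by positivity
  have ht₀0 : 0 < t₀ := by positivity
  set C₁ := N / (c₁ * a) + N + 2 + k₀ with hC₁
  have hC₁0 : 0 < C₁ := by positivity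
  refine ⟨C₁ * (t₀ + 1), by positivity, fun ε hε0 hε1 => ?_⟩
  set l := 1 + Real.log (1 / ε) with hl
  have hl1 : 1 ≤ l := by
    have := Real.log_nonneg (show 1 ≤ 1 / ε by rw [le_div_iff₀ hε0]; linarith)
    linarith
  have hε2 : 0 < ε ^ 2 := by positivity
  have hε21 : ε ^ 2 ≤ 1 := pow_le_one₀ hε0.le hε1.le
  have hα0 : 0 < a * ε ^ 2 := by positivity
  have hαa : a * ε ^ 2 ≤ a := mul_le_of_le_one_right ha0.le hε21
  have hlε : 1 ≤ l / ε ^ 2 := by rw [le_div_iff₀ hε2]; linarith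
  set K := mixingTime M π (a * ε ^ 2) + 1 + ⌈k₀ * (l / ε ^ 2)⌉₊ with hK
  set T := ⌈t₀ * l⌉₊
  set ρ := (1 - M.γ) * ε / 8 with hρ
  have hρ0 : 0 < ρ := by positivity
  refine ⟨a * ε ^ 2, K, T, hα0, hαa.trans halam, by omega, ?_, ρ, hρ0.le, by
    rw [hρ]; nlinarith, ?_, ?_⟩
  · have hKle : (K : ℝ) ≤ C₁ * (l / ε ^ 2) := by
      have h1 : (mixingTime M π (a * ε ^ 2) : ℝ) ≤ N * (1 / (c₁ * (a * ε ^ 2)) + 1) := by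
        calc (mixingTime M π (a * ε ^ 2) : ℝ) ≤ (N * ⌈1 / (c₁ * (a * ε ^ 2))⌉₊ : ℕ) := by
              exact_mod_cast mixingTime_le hc₁0 hc₁1 hc₁ hα0
          _ ≤ _ := by
              push_cast
              exact mul_le_mul_of_nonneg_left (Nat.ceil_lt_add_one (by positivity)).le
                N.cast_nonneg
      have h2 : (⌈k₀ * (l / ε ^ 2)⌉₊ : ℝ) ≤ k₀ * (l / ε ^ 2) + 1 :=
        (Nat.ceil_lt_add_one (by positivity)).le
      have h3 : N * (1 / (c₁ * (a * ε ^ 2))) ≤ N / (c₁ * a) * (l / ε ^ 2) := by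
        calc N * (1 / (c₁ * (a * ε ^ 2))) = N / (c₁ * a) * (1 / ε ^ 2) := by field_simp
          _ ≤ _ := by gcongr
      have h4 : (N : ℝ) + 2 ≤ (N + 2) * (l / ε ^ 2) :=
        le_mul_of_one_le_right (by positivity) hlε
      rw [hK, hC₁]
      push_cast
      linarith
    have hTle : (T : ℝ) ≤ (t₀ + 1) * l := by
      have : (T : ℝ) ≤ t₀ * l + 1 := (Nat.ceil_lt_add_one (by positivity)).le
      linarith
    push_cast
    calc (K : ℝ) * T ≤ C₁ * (l / ε ^ 2) * ((t₀ + 1) * l) :=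
          mul_le_mul hKle hTle T.cast_nonneg (by positivity)
      _ = _ := by ring
  · refine innerOp_iterate_norm_le hΦ1 hc0 hc1 hc hκ0 hκ hsurj hα0 (hαa.trans ha1) ?_ hρ0 ?_ ?_
    · exact (mul_le_mul_of_nonneg_left hαa (by positivity)).trans haN
    · have hpow : (1 - a * ε ^ 2 * c / 2) ^ K ≤ b * ε ^ 2 := by
        refine one_sub_pow_le_mul_pow (by nlinarith) hb0 hb1 hε0 hε1 ?_
        have h1 : k₀ * (l / ε ^ 2) ≤ K := by
          rw [hK]
          push_cast
          have := Nat.le_ceil (k₀ * (l / ε ^ 2))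
          have h0 : (0 : ℝ) ≤ mixingTime M π (a * ε ^ 2) := Nat.cast_nonneg _
          linarith
        refine le_trans (le_of_eq ?_)
          (mul_le_mul_of_nonneg_left h1 (show 0 ≤ a * ε ^ 2 * c / 2 by positivity))
        rw [hk₀, ← hl]
        push_cast
        field_simp
      calc 2 * κ * D ^ 2 * (1 - a * ε ^ 2 * c / 2) ^ K ≤ 2 * κ * D ^ 2 * (b * ε ^ 2) :=
            mul_le_mul_of_nonneg_left hpow (by positivity)
        _ = ρ ^ 2 / 2 := by
            rw [hb, hρ]
            field_simp
            norm_num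
    · calc G * (a * ε ^ 2) = G * a * ε ^ 2 := by ring
        _ ≤ (1 - M.γ) ^ 2 / 128 * ε ^ 2 := mul_le_mul_of_nonneg_right haG hε2.le
        _ = ρ ^ 2 / 2 := by rw [hρ]; ring
  · exact fun t ht => geometric_add_lt M.γ_pos M.γ_lt_one (norm_nonneg _) hε0 hε1
      ((Nat.le_ceil _).trans (by exact_mod_cast ht))

end Convergence

end TargetQ

end

theorem mainTheorem2 :
    ∃ p : ℕ,
      ∀ {S A : Type*} [Fintype S] [Fintype A] [DecidableEq S] [DecidableEq A]
        [Nonempty S] [Nonempty A]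
        (M : TargetQ.MDP S A) (π : TargetQ.Policy S A) (d : ℕ)
        (Φ : Matrix (S × A) (Fin d) ℝ),
        LinearIndependent ℝ (fun i : Fin d => fun x : S × A => Φ x i) →
        (∀ x : S × A, ∑ i, |Φ x i| ≤ 1) →
        d = Fintype.card S * Fintype.card A →
        TargetQ.IsExploring M π →
        ∃ C : ℝ, 0 < C ∧
          ∀ ε : ℝ, 0 < ε → ε < 1 →
            ∃ (α : ℝ) (K T : ℕ),
              0 < α ∧
              α ≤ TargetQ.lambdaMin M π Φ * (1 - M.γ) ^ 2 / 130 ∧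
              TargetQ.mixingTime M π α + 1 ≤ K ∧
              ((K * T : ℕ) : ℝ) ≤ C * (1 / ε ^ 2) * (1 + Real.log (1 / ε)) ^ p ∧
              ∀ {Ω : Type*} [MeasurableSpace Ω] (ℙ : MeasureTheory.Measure Ω)
                [MeasureTheory.IsProbabilityMeasure ℙ] (X : ℕ → Ω → S) (U : ℕ → Ω → A),
                TargetQ.IsTrajectory M π ℙ X U →
                ∀ T' : ℕ, T ≤ T' →
                  MeasureTheory.Integrable
                    (fun ω => ‖Φ *ᵥ TargetQ.targetIter M Φ (fun _ => α) K
                        (fun k => X k ω) (fun k => U k ω) T' - TargetQ.qStar M‖) ℙ ∧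
                  ∫ ω, ‖Φ *ᵥ TargetQ.targetIter M Φ (fun _ => α) K
                        (fun k => X k ω) (fun k => U k ω) T' - TargetQ.qStar M‖ ∂ℙ < ε := by
  refine ⟨2, fun {S A} _ _ _ _ _ _ M π d Φ hind hΦ1 hd hπ => ?_⟩
  have hinj : Function.Injective Φ.mulVec := Matrix.mulVec_injective_iff.2 hind
  have hsurj : Function.Surjective Φ.mulVec :=
    (LinearMap.injective_iff_surjective_of_finrank_eq_finrank (f := Φ.mulVecLin)
      (by simp [hd])).1 hinj
  have : NeZero d := ⟨by rw [hd]; positivity⟩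
  obtain ⟨C, hC, h⟩ := TargetQ.exists_sample_complexity_bound hπ hΦ1 hinj hsurj
    (TargetQ.lambdaMin_pos hπ hinj)
  refine ⟨C, hC, fun ε hε0 hε1 => ?_⟩
  obtain ⟨α, K, T, hα0, hα, hK, hKT, ρ, hρ0, hργ, hloop, hacc⟩ := h ε hε0 hε1
  refine ⟨α, K, T, hα0, hα, hK, hKT, fun {Ω} _ ℙ _ X U hT t ht => ⟨?_, ?_⟩⟩
  · exact hT.integrable_targetIter K t fun h _ => ‖Φ *ᵥ h - TargetQ.qStar M‖
  · exact (hT.integral_norm_targetIter_le hρ0 hργ hloop t).trans_lt (hacc t ht)
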